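/- For a positive integer $m$ let $[m]=\{1,\dots,m\}$. In the Dynamic Best Bichromatic Point problem one maintains a multiset $S$, initially empty, of at most $m$ points of $[m]\times[m]$, each coloured red or blue, under updates; an update inserts a coloured point of $[m]\times[m]$ (so that $|S|\le m$ still holds, counting multiplicities) or deletes one copy of a coloured point that is present in $S$. After every update one must return a red point $R=(x,y)\in S$ and a blue point $B=(x',y')\in S$ for which $\min(x,x')+\min(y,y')$ is as large as possible, or report that $S$ does not contain points of both colours. **Lemma.** There is a deterministic data structure on the word RAM for Dynamic Best Bichromatic Point that processes each update in $O(\log^2 m)$ amortized time. Precisely: there are one program and constants $c,C$ such that for all $m\ge 2$ and every word length $w\ge c\log_2 m$ the following holds. Start the word RAM with $w$-bit words with $m$ in a register and all other registers and memory cells zero (no preprocessing), and run the program once for each update of an arbitrary admissible sequence, the updates being revealed one at a time. Then each run halts and returns a correct answer for the current multiset, and any $k$ updates $(k\ge 0)$ from the start take at most $C\,k\,(\log_2 m)^2$ steps in total. Here a step is one instruction on $w$-bit words: loading a constant, an unsigned arithmetic, bitwise or shift operation on two registers, a read or write of the memory cell addressed by a register, or a comparison of two registers. -/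

import Mathlib

namespace BichromaticPoint

/-! ### The dynamic problem -/

/-- The two colours of points. -/
inductive Colour where
  | red
  | blue
  deriving DecidableEq

/-- A coloured point of the plane with natural coordinates. -/
structure Point where
  colour : Colour
  x : ℕ
  y : ℕ
  deriving DecidableEq

/-- The point lies in `[m] × [m]`, where `[m] = {1, …, m}`. -/
def Point.InGrid (m : ℕ) (p : Point) : Prop :=
  (1 ≤ p.x ∧ p.x ≤ m) ∧ (1 ≤ p.y ∧ p.y ≤ m)

/-- The objective `min(x, x') + min(y, y')`. -/
def pairValue (p q : Point) : ℕ := min p.x q.x + min p.y q.y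

/-- `p` is a red point and `q` is a blue point of the multiset `S`. -/
def IsBichromaticPair (S : Multiset Point) (p q : Point) : Prop :=
  p ∈ S ∧ q ∈ S ∧ p.colour = Colour.red ∧ q.colour = Colour.blue

/-- `(p, q)` is a best bichromatic pair of `S`. -/
def IsBestPair (S : Multiset Point) (p q : Point) : Prop :=
  IsBichromaticPair S p q ∧
    ∀ p' q' : Point, IsBichromaticPair S p' q' → pairValue p' q' ≤ pairValue p q

/-- An update inserts or deletes one copy of a coloured point. -/
inductive Update where
  | insert (p : Point)
  | delete (p : Point)

/-- The point that an update concerns. -/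
def Update.point : Update → Point
  | .insert p => p
  | .delete p => p

/-- The effect of an update on the multiset. -/
def Update.apply (S : Multiset Point) : Update → Multiset Point
  | .insert p => p ::ₘ S
  | .delete p => S.erase p

/-- When an update is allowed: an inserted point lies in `[m] × [m]` and the multiset keeps at most
`m` points (with multiplicity); a deleted point is present. -/
def Update.Allowed (m : ℕ) (S : Multiset Point) : Update → Prop
  | .insert p => p.InGrid m ∧ Multiset.card S + 1 ≤ m
  | .delete p => p ∈ S

/-- Every update of the sequence is allowed when it is issued, the multiset being `S` at first. -/
def ValidUpdates (m : ℕ) : Multiset Point → List Update → Prop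
  | _, [] => True
  | S, u :: us => u.Allowed m S ∧ ValidUpdates m (u.apply S) us

/-! ### The word RAM with words of `w` bits -/

/-- The arithmetic, bitwise and shift operations of the machine. -/
inductive BinOp where
  | add | sub | mul | div | mod | and | or | xor | shl | shr

/-- Unsigned arithmetic modulo `2 ^ w`; division is integer division. -/
def BinOp.eval {w : ℕ} : BinOp → BitVec w → BitVec w → BitVec w
  | .add, a, b => a + b
  | .sub, a, b => a - b
  | .mul, a, b => a * b
  | .div, a, b => a / b
  | .mod, a, b => a % b
  | .and, a, b => a &&& b
  | .or, a, b => a ||| b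
  | .xor, a, b => a ^^^ b
  | .shl, a, b => a <<< b
  | .shr, a, b => a >>> b

/-- Tests on the contents of two registers. -/
inductive Test where
  | eq (a b : ℕ)
  | lt (a b : ℕ)

/-- A configuration: registers, of which a program uses finitely many, and a random access memory
of `2 ^ w` words. -/
structure State (w : ℕ) where
  reg : ℕ → BitVec w
  mem : BitVec w → BitVec w

/-- The truth value of a test; `lt` compares words as unsigned numbers. -/
def Test.Holds {w : ℕ} (σ : State w) : Test → Prop
  | .eq a b => σ.reg a = σ.reg b
  | .lt a b => (σ.reg a).toNat < (σ.reg b).toNat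

/-- Write a word into a register. -/
def State.setReg {w : ℕ} (σ : State w) (d : ℕ) (v : BitVec w) : State w :=
  { σ with reg := Function.update σ.reg d v }

/-- Write a word into a memory cell. -/
def State.setMem {w : ℕ} (σ : State w) (a v : BitVec w) : State w :=
  { σ with mem := Function.update σ.mem a v }

/-- Elementary instructions. -/
inductive Instr where
  /-- `R[d] := k` -/
  | const (d k : ℕ)
  /-- `R[d] := R[a] ∘ R[b]` -/
  | op (o : BinOp) (d a b : ℕ)
  /-- `R[d] := M[R[a]]` -/
  | load (d a : ℕ)
  /-- `M[R[a]] := R[s]` -/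
  | store (a s : ℕ)

/-- The effect of an elementary instruction. -/
def Instr.exec {w : ℕ} (σ : State w) : Instr → State w
  | .const d k => σ.setReg d (BitVec.ofNat w k)
  | .op o d a b => σ.setReg d (o.eval (σ.reg a) (σ.reg b))
  | .load d a => σ.setReg d (σ.mem (σ.reg a))
  | .store a s => σ.setMem (σ.reg a) (σ.reg s)

/-- Programs. A program is a fixed finite text, which does not depend on the word length. -/
inductive Program where
  | skip
  | instr (i : Instr)
  | seq (p q : Program)
  | ite (b : Test) (p q : Program)
  | loop (b : Test) (p : Program)

/-- `Exec p σ σ' t`: the program `p`, started in `σ`, halts in `σ'` after `t` steps. Every elementary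
instruction and every evaluation of a test is one step; `loop b p` is `while b do p`. -/
inductive Exec {w : ℕ} : Program → State w → State w → ℕ → Prop where
  | skip (σ : State w) : Exec Program.skip σ σ 0
  | instr (i : Instr) (σ : State w) : Exec (Program.instr i) σ (i.exec σ) 1
  | seq {p q : Program} {σ σ' σ'' : State w} {t t' : ℕ} :
      Exec p σ σ' t → Exec q σ' σ'' t' → Exec (Program.seq p q) σ σ'' (t + t')
  | ite_true {b : Test} {p q : Program} {σ σ' : State w} {t : ℕ} :
      b.Holds σ → Exec p σ σ' t → Exec (Program.ite b p q) σ σ' (t + 1)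
  | ite_false {b : Test} {p q : Program} {σ σ' : State w} {t : ℕ} :
      ¬ b.Holds σ → Exec q σ σ' t → Exec (Program.ite b p q) σ σ' (t + 1)
  | loop_done {b : Test} {p : Program} {σ : State w} :
      ¬ b.Holds σ → Exec (Program.loop b p) σ σ 1
  | loop_step {b : Test} {p : Program} {σ σ' σ'' : State w} {t t' : ℕ} :
      b.Holds σ → Exec p σ σ' t → Exec (Program.loop b p) σ' σ'' t' →
        Exec (Program.loop b p) σ σ'' (t + t' + 1)

/-! ### Data structures on the word RAM -/

/-- The machine before the first update: register 0 holds `m`, everything else is zero. -/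
def initialState (w m : ℕ) : State w where
  reg := Function.update (fun _ => 0) 0 (BitVec.ofNat w m)
  mem := fun _ => 0

/-- The code of the kind of an update. -/
def Update.kindCode : Update → ℕ
  | .insert _ => 0
  | .delete _ => 1

/-- The code of a colour. -/
def Colour.code : Colour → ℕ
  | .red => 0
  | .blue => 1

/-- Hand an update to the machine: registers 1 to 4 receive its kind, the colour and the two
coordinates of its point; everything else stays as the machine left it. -/
def State.feed {w : ℕ} (σ : State w) (u : Update) : State w :=
  (((σ.setReg 1 (BitVec.ofNat w u.kindCode)).setReg 2 (BitVec.ofNat w u.point.colour.code)).setReg 3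
    (BitVec.ofNat w u.point.x)).setReg 4 (BitVec.ofNat w u.point.y)

/-- The answer shown by the machine is right for `S`: either register 5 is zero and `S` has no
bichromatic pair, or register 5 is nonzero, registers 6, 7 hold the coordinates of a red point,
registers 8, 9 those of a blue point, and these two form a best bichromatic pair of `S`. -/
def State.Answers {w : ℕ} (σ : State w) (S : Multiset Point) : Prop :=
  (σ.reg 5 = 0 ∧ ¬ ∃ p q : Point, IsBichromaticPair S p q) ∨
  (σ.reg 5 ≠ 0 ∧
    IsBestPair S ⟨Colour.red, (σ.reg 6).toNat, (σ.reg 7).toNat⟩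
      ⟨Colour.blue, (σ.reg 8).toNat, (σ.reg 9).toNat⟩)

/-- `Serves P σ S us t`: from the configuration `σ` representing `S`, running `P` once for each
update of `us`, in order and without access to later updates, always halts, shows a right answer
after every single update, and takes `t` steps in total. -/
inductive Serves {w : ℕ} (P : Program) : State w → Multiset Point → List Update → ℕ → Prop where
  | nil (σ : State w) (S : Multiset Point) : Serves P σ S [] 0
  | cons {σ σ' : State w} {S : Multiset Point} {u : Update} {us : List Update} {t t' : ℕ} :
      Exec P (σ.feed u) σ' t → σ'.Answers (u.apply S) → Serves P σ' (u.apply S) us t' →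
        Serves P σ S (u :: us) (t + t')

end BichromaticPoint

open BichromaticPoint

/-! The data structure is a two-dimensional segment tree. A node is a pair (a, b) of nodes of two
heap-indexed complete binary trees with N leaves, one over each coordinate; it stands for the
rectangle of points whose x-leaf lies under a and whose y-leaf lies under b. A point has leaf offset
2x + colour, respectively 2y + colour, so a pair of leaves determines its point, and a single leaf
of either tree never holds both colours.

Each rectangle stores its best bichromatic pair and, for each colour, the maxima of the features 0,
x, y and x + y. These satisfy a recursion. Two points of a rectangle lie in a common half, in the x-
or the y-direction, or in diagonally opposite quadrants. In the second case both minima are decided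
by the quadrants, so min(x, x') + min(y, y') is a feature of the red point plus a feature of the
blue point, and the best such pair comes from adding two stored maxima (`pairs_split`).

To have the maximizing points at hand, values are packed with coordinates in base B = 2N. Red
coordinates occupy higher digits than blue ones, so a red key plus a blue key is exactly the key of
the pair (`key_add_key`), and the pair is read off as digits (`unpack`). All keys are positive, so 0
encodes emptiness; zeroed memory is therefore a correct structure for the empty multiset
(`stored_empty`), and no preprocessing is needed.

An update affects only rectangles (a, b) with a and b ancestors of the two leaves of its point.
There are O(log² m) of them, and each is recomputed in constant time from its children
(`node_spec`). Going from the leaves to the roots, with the y-ancestors in the inner loop, the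
needed children are always already correct (`climb_spec`). The time bound thus holds for each single
update, not only on average.

Programs are verified over natural numbers: overflow is excluded by a syntactic degree bound in B
(`Expr.safe_of_vars`), and the cost of loop-free code is computed from its text (`Exec.le_cost`). -/

namespace BichromaticPoint

/-! ### Programs over natural numbers -/

/-- Contents of registers and memory as natural numbers. -/
structure NState where
  r : ℕ → ℕ
  M : ℕ → ℕ

/-- Write into a register. -/
def NState.set (s : NState) (x v : ℕ) : NState :=
  { s with r := fun i => if i = x then v else s.r i }

/-- Write into a memory cell. -/
def NState.put (s : NState) (a v : ℕ) : NState :=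
  { s with M := fun b => if b = a then v else s.M b }

@[simp] theorem NState.set_r (s : NState) (x v i : ℕ) :
    (s.set x v).r i = if i = x then v else s.r i := rfl

@[simp] theorem NState.set_M (s : NState) (x v : ℕ) : (s.set x v).M = s.M := rfl

@[simp] theorem NState.put_M (s : NState) (a v b : ℕ) :
    (s.put a v).M b = if b = a then v else s.M b := rfl

@[simp] theorem NState.put_r (s : NState) (a v : ℕ) : (s.put a v).r = s.r := rfl

theorem NState.set_self (s : NState) (x : ℕ) : s.set x (s.r x) = s := by
  cases s
  simp only [NState.set, NState.mk.injEq, and_true]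
  funext i
  split_ifs with h
  · rw [h]
  · rfl

/-- The registers below `30` and the memory of `σ` are those of `s`. The other registers serve to
evaluate expressions. -/
def Rep {w : ℕ} (σ : State w) (s : NState) : Prop :=
  (∀ i < 30, (σ.reg i).toNat = s.r i) ∧ ∀ a, (σ.mem a).toNat = s.M a.toNat

theorem Rep.setReg {w : ℕ} {σ : State w} {s : NState} (h : Rep σ s) (x : ℕ) (v : BitVec w) :
    Rep (σ.setReg x v) (s.set x v.toNat) := by
  refine ⟨fun i hi => ?_, h.2⟩
  by_cases hx : i = x
  · subst hx; simp [State.setReg]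
  · simp [State.setReg, hx, h.1 i hi]

theorem Rep.setMem {w : ℕ} {σ : State w} {s : NState} (h : Rep σ s) (a v : BitVec w) :
    Rep (σ.setMem a v) (s.put a.toNat v.toNat) := by
  refine ⟨h.1, fun b => ?_⟩
  by_cases hb : b = a
  · subst hb; simp [State.setMem]
  · simp [State.setMem, hb, h.2 b, BitVec.toNat_inj]

/-! ### Compilation of arithmetic expressions, without overflow. -/

/-- Arithmetic expressions in the registers. -/
inductive Expr where
  | const (k : ℕ)
  | var (i : ℕ)
  | add (a b : Expr)
  | mul (a b : Expr)
  | div (a b : Expr)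
  | mod (a b : Expr)

namespace Expr

/-- The value of an expression. -/
@[simp] def eval (s : NState) : Expr → ℕ
  | const k => k
  | var i => s.r i
  | add a b => a.eval s + b.eval s
  | mul a b => a.eval s * b.eval s
  | div a b => a.eval s / b.eval s
  | mod a b => a.eval s % b.eval s

/-- No overflow occurs when an expression is evaluated with words below `W`. -/
@[simp] def Safe (W : ℕ) (s : NState) : Expr → Prop
  | const k => k < W
  | var i => i < 30
  | add a b => a.Safe W s ∧ b.Safe W s ∧ a.eval s + b.eval s < W
  | mul a b => a.Safe W s ∧ b.Safe W s ∧ a.eval s * b.eval s < W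
  | div a b => a.Safe W s ∧ b.Safe W s
  | mod a b => a.Safe W s ∧ b.Safe W s

/-- Evaluate an expression into register `d`, using registers from `d` on. -/
def code : Expr → ℕ → Program
  | const k, d => .instr (.const d k)
  -- The disjunction of a word with itself serves as a register copy.
  | var i, d => .instr (.op .or d i i)
  | add a b, d => .seq (a.code d) (.seq (b.code (d + 1)) (.instr (.op .add d d (d + 1))))
  | mul a b, d => .seq (a.code d) (.seq (b.code (d + 1)) (.instr (.op .mul d d (d + 1))))
  | div a b, d => .seq (a.code d) (.seq (b.code (d + 1)) (.instr (.op .div d d (d + 1))))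
  | mod a b, d => .seq (a.code d) (.seq (b.code (d + 1)) (.instr (.op .mod d d (d + 1))))

/-- Stack discipline: the first operand waits in register `d` while the second is evaluated using
only registers above `d`. The hypothesis on `q` ranges over all states that `p` may leave behind. -/
theorem exec_binary {w : ℕ} {σ : State w} {d va vb v : ℕ} {p q : Program} (o : BinOp)
    (hp : ∃ σ' t, Exec p σ σ' t ∧ (σ'.reg d).toNat = va ∧ (∀ i < d, σ'.reg i = σ.reg i) ∧
      σ'.mem = σ.mem)
    (hq : ∀ σ₁ : State w, (∀ i < d, σ₁.reg i = σ.reg i) → σ₁.mem = σ.mem →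
      ∃ σ' t, Exec q σ₁ σ' t ∧ (σ'.reg (d + 1)).toNat = vb ∧
        (∀ i < d + 1, σ'.reg i = σ₁.reg i) ∧ σ'.mem = σ₁.mem)
    (ho : ∀ a b : BitVec w, a.toNat = va → b.toNat = vb → (o.eval a b).toNat = v) :
    ∃ σ' t, Exec (.seq p (.seq q (.instr (.op o d d (d + 1))))) σ σ' t ∧ (σ'.reg d).toNat = v ∧
      (∀ i < d, σ'.reg i = σ.reg i) ∧ σ'.mem = σ.mem := by
  obtain ⟨σ₁, t₁, e₁, h₁, f₁, m₁⟩ := hp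
  obtain ⟨σ₂, t₂, e₂, h₂, f₂, m₂⟩ := hq σ₁ f₁ m₁
  refine ⟨_, _, e₁.seq (e₂.seq (.instr _ _)), ?_, fun i hi => ?_, m₂.trans m₁⟩
  · simp only [Instr.exec, State.setReg, Function.update_self]
    exact ho _ _ (by rw [f₂ d (by omega), h₁]) h₂
  · simp only [Instr.exec, State.setReg]
    rw [Function.update_of_ne (by omega), f₂ i (by omega), f₁ i hi]

theorem code_spec {w : ℕ} (s : NState) (e : Expr) : ∀ (d : ℕ) (σ : State w), 30 ≤ d → Rep σ s →
    e.Safe (2 ^ w) s → ∃ σ' t, Exec (e.code d) σ σ' t ∧ (σ'.reg d).toNat = e.eval s ∧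
      (∀ i < d, σ'.reg i = σ.reg i) ∧ σ'.mem = σ.mem := by
  have key : ∀ {d : ℕ} {σ σ₁ : State w}, 30 ≤ d → Rep σ s → (∀ i < d, σ₁.reg i = σ.reg i) →
      σ₁.mem = σ.mem → Rep σ₁ s := fun hd hr hf hm =>
    ⟨fun i hi => by rw [hf i (by omega), hr.1 i hi], fun a => by rw [hm, hr.2 a]⟩
  induction e with
  | const k =>
    intro d σ hd hr hs
    refine ⟨_, _, .instr _ _, ?_, fun i hi => ?_, rfl⟩
    · simpa [Instr.exec, State.setReg] using Nat.mod_eq_of_lt hs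
    · simp [Instr.exec, State.setReg, hi.ne]
  | var j =>
    intro d σ hd hr hs
    refine ⟨_, _, .instr _ _, ?_, fun i hi => ?_, rfl⟩
    · simpa [Instr.exec, State.setReg, BinOp.eval] using hr.1 j hs
    · simp [Instr.exec, State.setReg, hi.ne]
  | add a b iha ihb =>
    intro d σ hd hr hs
    refine exec_binary _ (iha d σ hd hr hs.1)
      (fun σ₁ hf hm => ihb (d + 1) σ₁ (by omega) (key hd hr hf hm) hs.2.1) fun x y hx hy => ?_
    simpa [BinOp.eval, hx, hy] using Nat.mod_eq_of_lt hs.2.2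
  | mul a b iha ihb =>
    intro d σ hd hr hs
    refine exec_binary _ (iha d σ hd hr hs.1)
      (fun σ₁ hf hm => ihb (d + 1) σ₁ (by omega) (key hd hr hf hm) hs.2.1) fun x y hx hy => ?_
    simpa [BinOp.eval, hx, hy] using Nat.mod_eq_of_lt hs.2.2
  | div a b iha ihb =>
    intro d σ hd hr hs
    refine exec_binary _ (iha d σ hd hr hs.1)
      (fun σ₁ hf hm => ihb (d + 1) σ₁ (by omega) (key hd hr hf hm) hs.2) fun x y hx hy => ?_
    simp [BinOp.eval, hx, hy]
  | mod a b iha ihb =>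
    intro d σ hd hr hs
    refine exec_binary _ (iha d σ hd hr hs.1)
      (fun σ₁ hf hm => ihb (d + 1) σ₁ (by omega) (key hd hr hf hm) hs.2) fun x y hx hy => ?_
    simp [BinOp.eval, hx, hy]

/-- The registers that occur in an expression. -/
@[simp] def vars : Expr → List ℕ
  | const _ => []
  | var i => [i]
  | add a b => a.vars ++ b.vars
  | mul a b => a.vars ++ b.vars
  | div a b => a.vars ++ b.vars
  | mod a b => a.vars ++ b.vars

/-- Bounds the degree of the value of an expression in `B`, if the registers are below `B ^ 2`. -/
@[simp] def deg : Expr → ℕ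
  | const k => k.size
  | var _ => 2
  | add a b => max a.deg b.deg + 1
  | mul a b => a.deg + b.deg
  | div a b => max a.deg b.deg
  | mod a b => max a.deg b.deg

/-- Reduces overflow to a comparison of degrees that can be decided from the text. As `B ≥ 2`, an
addition costs one degree and a constant `k` is below `B ^ k.size`. -/
theorem safe_of_vars {B W : ℕ} (hB : 2 ≤ B) (s : NState) (e : Expr)
    (hv : ∀ i ∈ e.vars, i < 30 ∧ s.r i < B ^ 2) (hd : B ^ e.deg ≤ W) :
    e.Safe W s ∧ e.eval s < B ^ e.deg := by
  have mono : ∀ {i j : ℕ}, i ≤ j → B ^ i ≤ B ^ j := fun h => Nat.pow_le_pow_right (by omega) h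
  induction e with
  | const k =>
    have h : k < B ^ k.size := (Nat.lt_size_self k).trans_le (Nat.pow_le_pow_left hB _)
    exact ⟨h.trans_le hd, h⟩
  | var i => exact hv i (by simp)
  | add a b iha ihb =>
    simp only [vars, List.mem_append] at hv
    have h1 : B ^ a.deg ≤ B ^ max a.deg b.deg := mono (le_max_left _ _)
    have h2 : B ^ b.deg ≤ B ^ max a.deg b.deg := mono (le_max_right _ _)
    have h3 : 2 * B ^ max a.deg b.deg ≤ B ^ (add a b).deg := by
      simp only [deg, pow_succ]
      rw [mul_comm]
      exact Nat.mul_le_mul_left _ hB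
    obtain ⟨sa, va⟩ := iha (fun i hi => hv i (.inl hi)) (by omega)
    obtain ⟨sb, vb⟩ := ihb (fun i hi => hv i (.inr hi)) (by omega)
    simp only [Safe, eval]
    exact ⟨⟨sa, sb, by omega⟩, by omega⟩
  | mul a b iha ihb =>
    simp only [vars, List.mem_append] at hv
    obtain ⟨sa, va⟩ := iha (fun i hi => hv i (.inl hi)) ((mono (Nat.le_add_right _ _)).trans hd)
    obtain ⟨sb, vb⟩ := ihb (fun i hi => hv i (.inr hi)) ((mono (Nat.le_add_left _ _)).trans hd)
    have h : a.eval s * b.eval s < B ^ (mul a b).deg := by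
      simp only [deg, pow_add]
      exact Nat.mul_lt_mul'' va vb
    exact ⟨⟨sa, sb, h.trans_le hd⟩, h⟩
  | div a b iha ihb =>
    simp only [vars, List.mem_append] at hv
    have h1 : B ^ a.deg ≤ B ^ (div a b).deg := mono (le_max_left _ _)
    have h2 : B ^ b.deg ≤ B ^ (div a b).deg := mono (le_max_right _ _)
    obtain ⟨sa, va⟩ := iha (fun i hi => hv i (.inl hi)) (h1.trans hd)
    obtain ⟨sb, vb⟩ := ihb (fun i hi => hv i (.inr hi)) (h2.trans hd)
    exact ⟨⟨sa, sb⟩, ((Nat.div_le_self _ _).trans_lt va).trans_le h1⟩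
  | mod a b iha ihb =>
    simp only [vars, List.mem_append] at hv
    have h1 : B ^ a.deg ≤ B ^ (mod a b).deg := mono (le_max_left _ _)
    have h2 : B ^ b.deg ≤ B ^ (mod a b).deg := mono (le_max_right _ _)
    obtain ⟨sa, va⟩ := iha (fun i hi => hv i (.inl hi)) (h1.trans hd)
    obtain ⟨sb, vb⟩ := ihb (fun i hi => hv i (.inr hi)) (h2.trans hd)
    exact ⟨⟨sa, sb⟩, ((Nat.mod_le _ _).trans_lt va).trans_le h1⟩

end Expr

/-! ### Basic commands and Hoare-style rules, with and without time bounds. -/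

/-- Assign the value of an expression to a register. -/
def assign (x : ℕ) (e : Expr) : Program := .seq (e.code 30) (.instr (.op .or x 30 30))

/-- Read the memory cell addressed by an expression. -/
def fetch (x : ℕ) (e : Expr) : Program := .seq (e.code 30) (.instr (.load x 30))

/-- Write a register into the memory cell addressed by an expression. -/
def write (e : Expr) (x : ℕ) : Program := .seq (e.code 30) (.instr (.store 30 x))

/-- Started in a state represented by `s`, the program halts within `t` steps, in a state
represented by one with property `Q`. -/
def HaltsIn (w : ℕ) (p : Program) (s : NState) (t : ℕ) (Q : NState → Prop) : Prop :=
  ∀ σ : State w, Rep σ s → ∃ σ' s' t', Exec p σ σ' t' ∧ t' ≤ t ∧ Rep σ' s' ∧ Q s'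

/-- `HaltsIn` without a time bound. -/
def Halts (w : ℕ) (p : Program) (s : NState) (Q : NState → Prop) : Prop :=
  ∀ σ : State w, Rep σ s → ∃ σ' s' t', Exec p σ σ' t' ∧ Rep σ' s' ∧ Q s'

/-- The program has no loops. -/
def LoopFree : Program → Bool
  | .skip => true
  | .instr _ => true
  | .seq p q => LoopFree p && LoopFree q
  | .ite _ p q => LoopFree p && LoopFree q
  | .loop _ _ => false

/-- A bound for the number of steps of a program without loops. -/
def cost : Program → ℕ
  | .skip => 0
  | .instr _ => 1
  | .seq p q => cost p + cost q
  | .ite _ p q => max (cost p) (cost q) + 1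
  | .loop _ _ => 0

/-- Separates time from correctness: loop-free code is verified with `Halts`, and its step count is
a number that can be evaluated. Only loops need `HaltsIn`. -/
theorem Exec.le_cost {w : ℕ} {p : Program} {σ σ' : State w} {t : ℕ} (h : Exec p σ σ' t) :
    LoopFree p → t ≤ cost p := by
  induction h with
  | skip => simp
  | instr => simp [cost]
  | seq _ _ ih1 ih2 =>
    simp only [LoopFree, Bool.and_eq_true, cost]
    exact fun h => Nat.add_le_add (ih1 h.1) (ih2 h.2)
  | ite_true _ _ ih =>
    simp only [LoopFree, Bool.and_eq_true, cost]
    exact fun h => Nat.succ_le_succ ((ih h.1).trans (le_max_left _ _))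
  | ite_false _ _ ih =>
    simp only [LoopFree, Bool.and_eq_true, cost]
    exact fun h => Nat.succ_le_succ ((ih h.2).trans (le_max_right _ _))
  | loop_done => simp [LoopFree]
  | loop_step => simp [LoopFree]

section Rules

variable {w : ℕ} {p q : Program} {s : NState} {Q R : NState → Prop}

theorem Halts.haltsIn {t : ℕ} (h : Halts w p s Q) (hp : LoopFree p = true) (ht : cost p ≤ t) :
    HaltsIn w p s t Q := fun σ hσ => by
  obtain ⟨σ', s', t', he, hr, hQ⟩ := h σ hσ
  exact ⟨σ', s', t', he, (he.le_cost hp).trans ht, hr, hQ⟩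

theorem Halts.mono (h : Halts w p s Q) (hQ : ∀ s', Q s' → R s') : Halts w p s R := fun σ hσ => by
  obtain ⟨σ', s', t', he, hr, hs⟩ := h σ hσ
  exact ⟨σ', s', t', he, hr, hQ _ hs⟩

theorem HaltsIn.mono {t t' : ℕ} (h : HaltsIn w p s t Q) (ht : t ≤ t') (hQ : ∀ s', Q s' → R s') :
    HaltsIn w p s t' R := fun σ hσ => by
  obtain ⟨σ', s', t₁, he, hl, hr, hs⟩ := h σ hσ
  exact ⟨σ', s', t₁, he, hl.trans ht, hr, hQ _ hs⟩

theorem Halts.skip (h : Q s) : Halts w .skip s Q := fun σ hσ => ⟨σ, s, 0, .skip σ, hσ, h⟩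

theorem Halts.seq (h : Halts w p s fun s' => Halts w q s' Q) : Halts w (.seq p q) s Q :=
  fun σ hσ => by
    obtain ⟨σ₁, s₁, t₁, e₁, r₁, h₁⟩ := h σ hσ
    obtain ⟨σ₂, s₂, t₂, e₂, r₂, h₂⟩ := h₁ σ₁ r₁
    exact ⟨σ₂, s₂, _, e₁.seq e₂, r₂, h₂⟩

theorem HaltsIn.seq {t t' : ℕ} (h : HaltsIn w p s t fun s' => HaltsIn w q s' t' Q) :
    HaltsIn w (.seq p q) s (t + t') Q :=
  fun σ hσ => by
    obtain ⟨σ₁, s₁, t₁, e₁, l₁, r₁, h₁⟩ := h σ hσ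
    obtain ⟨σ₂, s₂, t₂, e₂, l₂, r₂, h₂⟩ := h₁ σ₁ r₁
    exact ⟨σ₂, s₂, _, e₁.seq e₂, Nat.add_le_add l₁ l₂, r₂, h₂⟩

theorem Rep.of_eq {σ σ' : State w} (h : Rep σ s) (hr : ∀ i < 30, σ'.reg i = σ.reg i)
    (hm : σ'.mem = σ.mem) : Rep σ' s :=
  ⟨fun i hi => by rw [hr i hi, h.1 i hi], fun a => by rw [hm, h.2 a]⟩

theorem Halts.assign {x : ℕ} {e : Expr} (he : e.Safe (2 ^ w) s) (h : Q (s.set x (e.eval s))) :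
    Halts w (assign x e) s Q := fun σ hσ => by
  obtain ⟨σ', t, ex, hv, hr, hm⟩ := e.code_spec s 30 σ le_rfl hσ he
  refine ⟨_, _, _, ex.seq (.instr _ _), ?_, h⟩
  rw [← hv]
  simpa [Instr.exec, BinOp.eval] using (hσ.of_eq hr hm).setReg x (σ'.reg 30)

theorem Halts.fetch {x : ℕ} {e : Expr} (he : e.Safe (2 ^ w) s)
    (h : Q (s.set x (s.M (e.eval s)))) : Halts w (fetch x e) s Q := fun σ hσ => by
  obtain ⟨σ', t, ex, hv, hr, hm⟩ := e.code_spec s 30 σ le_rfl hσ he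
  refine ⟨_, _, _, ex.seq (.instr _ _), ?_, h⟩
  rw [← hv, ← (hσ.of_eq hr hm).2]
  exact (hσ.of_eq hr hm).setReg x _

theorem Halts.write {x : ℕ} {e : Expr} (he : e.Safe (2 ^ w) s) (hx : x < 30)
    (h : Q (s.put (e.eval s) (s.r x))) : Halts w (write e x) s Q := fun σ hσ => by
  obtain ⟨σ', t, ex, hv, hr, hm⟩ := e.code_spec s 30 σ le_rfl hσ he
  refine ⟨_, _, _, ex.seq (.instr _ _), ?_, h⟩
  rw [← hv, ← (hσ.of_eq hr hm).1 x hx]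
  exact (hσ.of_eq hr hm).setMem _ _

/-- Subtraction is kept out of `Expr` because it needs a comparison of its operands rather than an
upper bound; it is used only to decrement a multiplicity. -/
theorem Halts.sub {x a b : ℕ} (ha : a < 30) (hb : b < 30) (hab : s.r b ≤ s.r a)
    (h : Q (s.set x (s.r a - s.r b))) : Halts w (.instr (.op .sub x a b)) s Q := fun σ hσ => by
  refine ⟨_, _, _, .instr _ _, ?_, h⟩
  have h1 : s.r a - s.r b = (σ.reg a - σ.reg b).toNat := by
    rw [← hσ.1 a ha, ← hσ.1 b hb, BitVec.toNat_sub_of_le]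
    rw [BitVec.le_def, hσ.1 a ha, hσ.1 b hb]
    exact hab
  rw [h1]
  exact hσ.setReg x _

theorem holds_lt {σ : State w} (hσ : Rep σ s) {a b : ℕ} (ha : a < 30) (hb : b < 30) :
    (Test.lt a b).Holds σ ↔ s.r a < s.r b := by
  simp only [Test.Holds, hσ.1 a ha, hσ.1 b hb]

theorem holds_eq {σ : State w} (hσ : Rep σ s) {a b : ℕ} (ha : a < 30) (hb : b < 30) :
    (Test.eq a b).Holds σ ↔ s.r a = s.r b := by
  simp only [Test.Holds, ← hσ.1 a ha, ← hσ.1 b hb, BitVec.toNat_inj]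

theorem Halts.ite_of_iff {b : Test} {c : Prop} (hc : ∀ σ : State w, Rep σ s → (b.Holds σ ↔ c))
    (h1 : c → Halts w p s Q) (h2 : ¬ c → Halts w q s Q) : Halts w (.ite b p q) s Q :=
  fun σ hσ => by
    by_cases h : c
    · obtain ⟨σ', s', t, e, r⟩ := h1 h σ hσ
      exact ⟨σ', s', _, .ite_true ((hc σ hσ).2 h) e, r⟩
    · obtain ⟨σ', s', t, e, r⟩ := h2 h σ hσ
      exact ⟨σ', s', _, .ite_false (mt (hc σ hσ).1 h) e, r⟩

theorem Halts.ite_lt {a b : ℕ} (ha : a < 30) (hb : b < 30)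
    (h1 : s.r a < s.r b → Halts w p s Q) (h2 : s.r b ≤ s.r a → Halts w q s Q) :
    Halts w (.ite (.lt a b) p q) s Q :=
  .ite_of_iff (fun _ hσ => holds_lt hσ ha hb) h1 fun h => h2 (not_lt.1 h)

theorem Halts.ite_eq {a b : ℕ} (ha : a < 30) (hb : b < 30)
    (h1 : s.r a = s.r b → Halts w p s Q) (h2 : s.r a ≠ s.r b → Halts w q s Q) :
    Halts w (.ite (.eq a b) p q) s Q :=
  .ite_of_iff (fun _ hσ => holds_eq hσ ha hb) h1 h2

/-- A loop whose invariant `I n` bounds the number of further rounds by `n`. -/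
theorem HaltsIn.loop {a b t : ℕ} (ha : a < 30) (hb : b < 30) (I : ℕ → NState → Prop)
    (h0 : ∀ s, I 0 s → s.r b ≤ s.r a)
    (hI : ∀ n s, I (n + 1) s → s.r a < s.r b → HaltsIn w p s t (I n)) (n : ℕ) :
    ∀ s, I n s → HaltsIn w (.loop (.lt a b) p) s (n * (t + 1) + 1)
      fun s' => (∃ n', I n' s') ∧ s'.r b ≤ s'.r a := by
  have done : ∀ n s, I n s → s.r b ≤ s.r a → HaltsIn w (.loop (.lt a b) p) s (n * (t + 1) + 1)
      fun s' => (∃ n', I n' s') ∧ s'.r b ≤ s'.r a := fun n s hs hab σ hσ =>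
    ⟨σ, s, 1, .loop_done (mt (holds_lt hσ ha hb).1 (not_lt.2 hab)), by omega, hσ, ⟨n, hs⟩, hab⟩
  induction n with
  | zero => exact fun s hs => done 0 s hs (h0 s hs)
  | succ n ih =>
    intro s hs
    rcases le_or_gt (s.r b) (s.r a) with hab | hab
    · exact done _ s hs hab
    · intro σ hσ
      obtain ⟨σ₁, s₁, t₁, e₁, l₁, r₁, h₁⟩ := hI n s hs hab σ hσ
      obtain ⟨σ₂, s₂, t₂, e₂, l₂, r₂, h₂⟩ := ih s₁ h₁ σ₁ r₁
      refine ⟨σ₂, s₂, _, .loop_step ((holds_lt hσ ha hb).2 hab) e₁ e₂, ?_, r₂, h₂⟩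
      rw [Nat.succ_mul]
      omega

end Rules

/-! ### Maxima of sets of naturals, with `0` for the empty set -/

/-- `n` is the maximum of `A`, or `n = 0` and `A ⊆ {0}`. -/
def Top (A : Set ℕ) (n : ℕ) : Prop := (∀ a ∈ A, a ≤ n) ∧ (n ≠ 0 → n ∈ A)

theorem Top.empty : Top ∅ 0 := ⟨by simp, by simp⟩

theorem Top.singleton (n : ℕ) : Top {n} n := ⟨by simp, by simp⟩

theorem Top.union {A A' : Set ℕ} {n n' : ℕ} (h : Top A n) (h' : Top A' n') :
    Top (A ∪ A') (max n n') := by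
  constructor
  · rintro a (ha | ha)
    · exact (h.1 a ha).trans (le_max_left _ _)
    · exact (h'.1 a ha).trans (le_max_right _ _)
  · intro h0
    rcases le_total n n' with hn | hn
    · rw [max_eq_right hn] at h0 ⊢
      exact .inr (h'.2 h0)
    · rw [max_eq_left hn] at h0 ⊢
      exact .inl (h.2 h0)

/-- The sums of an element of `A` and an element of `A'`. -/
def sumset (A A' : Set ℕ) : Set ℕ := {k | ∃ a ∈ A, ∃ b ∈ A', k = a + b}

/-- The sum of two maxima, `0` if one of the sets is empty. -/
def pairSum (a b : ℕ) : ℕ := if a = 0 ∨ b = 0 then 0 else a + b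

/-- Positivity makes the code 0 unambiguous: a zero maximum means an empty factor, and then the
sumset is empty too. -/
theorem Top.sumset {A A' : Set ℕ} {n n' : ℕ} (h : Top A n) (h' : Top A' n')
    (hA : ∀ a ∈ A, 0 < a) (hA' : ∀ a ∈ A', 0 < a) : Top (sumset A A') (pairSum n n') := by
  constructor
  · rintro _ ⟨a, ha, b, hb, rfl⟩
    have h1 := h.1 a ha
    have h2 := h'.1 b hb
    have h3 := hA a ha
    have h4 := hA' b hb
    rw [pairSum, if_neg (by omega)]
    omega
  · intro h0
    rw [pairSum] at h0 ⊢
    split_ifs at h0 ⊢ with hn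
    · exact absurd rfl h0
    · rw [not_or] at hn
      exact ⟨n, h.2 hn.1, n', h'.2 hn.2, rfl⟩

/-! ### Nodes of the heap-indexed binary tree -/

/-- `a` is an ancestor of `l` in the binary tree where `a` has the children `2a`, `2a + 1`. -/
def Under (a l : ℕ) : Prop := ∃ k, l / 2 ^ k = a

theorem Under.refl (l : ℕ) : Under l l := ⟨0, by simp⟩

theorem under_one {l : ℕ} (hl : 1 ≤ l) : Under 1 l := by
  refine ⟨Nat.log 2 l, ?_⟩
  have h1 := Nat.pow_log_le_self 2 (x := l) (by omega)
  have h2 := Nat.lt_pow_succ_log_self (b := 2) (by omega) l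
  rw [pow_succ] at h2
  exact Nat.div_eq_of_lt_le (by omega) (by omega)

theorem Under.le {a l : ℕ} (h : Under a l) : a ≤ l := by
  obtain ⟨k, rfl⟩ := h
  exact Nat.div_le_self _ _

theorem Under.half {a l : ℕ} (h : Under a l) : Under (a / 2) l := by
  obtain ⟨k, rfl⟩ := h
  exact ⟨k + 1, by rw [pow_succ, Nat.div_div_eq_div_mul]⟩

/-- The ancestors of a leaf form a chain under halving, so the next one after `v` is `v / 2`. This
is what lets the climb skip everything in between. -/
theorem Under.le_half {a l v : ℕ} (h : Under a l) (hv : Under v l) (hav : a < v) :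
    a ≤ v / 2 := by
  obtain ⟨k, rfl⟩ := h
  obtain ⟨j, rfl⟩ := hv
  have hjk : j < k := by
    by_contra hc
    have : l / 2 ^ j ≤ l / 2 ^ k := Nat.div_le_div_left
      (Nat.pow_le_pow_right (by omega) (not_lt.1 hc)) (by positivity)
    omega
  rw [Nat.div_div_eq_div_mul, ← pow_succ]
  exact Nat.div_le_div_left (Nat.pow_le_pow_right (by omega) hjk) (by positivity)

theorem under_iff {N a l : ℕ} (ha : a < N) (hl : N ≤ l) :
    Under a l ↔ Under (2 * a) l ∨ Under (2 * a + 1) l := by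
  constructor
  · rintro ⟨k, hk⟩
    cases k with
    | zero => simp at hk; omega
    | succ k =>
      rw [pow_succ, ← Nat.div_div_eq_div_mul] at hk
      have h : l / 2 ^ k = 2 * a ∨ l / 2 ^ k = 2 * a + 1 := by omega
      exact h.imp (fun h => ⟨k, h⟩) fun h => ⟨k, h⟩
  · rintro (h | h)
    · simpa using h.half
    · have := h.half
      rwa [show (2 * a + 1) / 2 = a by omega] at this

theorem under_leaf {N a l : ℕ} (ha : N ≤ a) (hl : l < 2 * N) : Under a l ↔ a = l := by
  refine ⟨?_, fun h => h ▸ Under.refl a⟩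
  rintro ⟨k, rfl⟩
  cases k with
  | zero => simp
  | succ k =>
    exfalso
    have : l / 2 ^ (k + 1) ≤ l / 2 := Nat.div_le_div_left
      (by simpa using Nat.pow_le_pow_right (n := 2) (by omega) (show 1 ≤ k + 1 by omega)) (by omega)
    omega

/-- Leaves in `[2 ^ K, 2 ^ (K + 1))` have equal depth, and so have siblings; hence the same number
of halvings leads from `l` to `2 * a` and from `l'` to `2 * a + 1`, and division is monotone. -/
theorem lt_of_under {K a l l' : ℕ} (ha : 1 ≤ a) (hl : l < 2 * 2 ^ K)
    (hl' : 2 ^ K ≤ l') (h : Under (2 * a) l) (h' : Under (2 * a + 1) l') : l < l' := by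
  obtain ⟨j, hj⟩ := h
  obtain ⟨k, hk⟩ := h'
  -- The negation `l' ≤ l` also supplies the two missing bounds that put both leaves on level `K`.
  by_contra hc
  have hlK : Nat.log 2 l = K := Nat.log_eq_of_pow_le_of_lt_pow (by omega) (by rw [pow_succ]; omega)
  have hlK' : Nat.log 2 l' = K :=
    Nat.log_eq_of_pow_le_of_lt_pow (by omega) (by rw [pow_succ]; omega)
  have e1 : Nat.log 2 (2 * a) = K - j := by rw [← hj, Nat.log_div_base_pow, hlK]
  have e2 : Nat.log 2 (2 * a + 1) = K - k := by rw [← hk, Nat.log_div_base_pow, hlK']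
  have e3 : Nat.log 2 (2 * a + 1) = Nat.log 2 (2 * a) := by
    rw [Nat.log_of_one_lt_of_le (by omega) (by omega), Nat.log_of_one_lt_of_le (n := 2 * a)
      (by omega) (by omega)]
    congr 2
    omega
  -- Rules out truncation in `K - j = K - k`, which then gives `j = k`.
  have e4 : 1 ≤ Nat.log 2 (2 * a) := Nat.log_pos (by omega) (by omega)
  have : j = k := by omega
  subst this
  have := Nat.div_le_div_right (c := 2 ^ j) (not_lt.1 hc)
  omega

/-! ### Keys of points and pairs -/

/-- The number of leaves of the trees, a power of two. -/
def treeSize (m : ℕ) : ℕ := 2 ^ Nat.clog 2 (2 * m + 2)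

theorem lt_treeSize (m : ℕ) : 2 * m + 2 ≤ treeSize m := Nat.le_pow_clog (by omega) _

theorem treeSize_lt (m : ℕ) : treeSize m < 2 * (2 * m + 2) := by
  have h := Nat.pow_pred_clog_lt_self (b := 2) (x := 2 * m + 2) (by omega) (by omega)
  have h2 : 1 ≤ Nat.clog 2 (2 * m + 2) := Nat.clog_pos (by omega) (by omega)
  rw [treeSize]
  obtain ⟨k, hk⟩ := Nat.exists_eq_add_of_le' h2
  rw [hk] at h ⊢
  rw [pow_succ]
  simp at h
  omega

/-- The number base used to pack several numbers into a word. -/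
def base (m : ℕ) : ℕ := 2 * treeSize m

/-- The four features of a point by which it is compared with others. -/
def feat : ℕ → Point → ℕ
  | 0, _ => 0
  | 1, p => p.x
  | 2, p => p.y
  | _, p => p.x + p.y

/-- The coordinates of a point, packed. -/
def pack (B : ℕ) (p : Point) : ℕ := p.x * B + p.y

/-- The factor with which the packed coordinates of a point occur in its keys. -/
def Colour.scale (B : ℕ) : Colour → ℕ
  | .red => B ^ 2
  | .blue => 1

/-- The value of a feature, packed with the point. -/
def key (B f : ℕ) (p : Point) : ℕ := feat f p * B ^ 4 + pack B p * p.colour.scale B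

/-- The value of a pair, packed with the pair. -/
def pairKey (B : ℕ) (p q : Point) : ℕ := pairValue p q * B ^ 4 + pack B p * B ^ 2 + pack B q

/-- The leaf of a point in the tree over the first coordinates. -/
def leafX (N : ℕ) (p : Point) : ℕ := N + (p.x + p.x + p.colour.code)

/-- The leaf of a point in the tree over the second coordinates. -/
def leafY (N : ℕ) (p : Point) : ℕ := N + (p.y + p.y + p.colour.code)

/-- The keys of the points of one colour in the rectangle of a pair of nodes. -/
def keys (m : ℕ) (S : Multiset Point) (c : Colour) (f a b : ℕ) : Set ℕ :=
  {k | ∃ p ∈ S, p.colour = c ∧ Under a (leafX (treeSize m) p) ∧ Under b (leafY (treeSize m) p) ∧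
    k = key (base m) f p}

/-- The keys of the bichromatic pairs in the rectangle of a pair of nodes. -/
def pairs (m : ℕ) (S : Multiset Point) (a b : ℕ) : Set ℕ :=
  {k | ∃ p q, IsBichromaticPair S p q ∧
    (Under a (leafX (treeSize m) p) ∧ Under b (leafY (treeSize m) p)) ∧
    (Under a (leafX (treeSize m) q) ∧ Under b (leafY (treeSize m) q)) ∧ k = pairKey (base m) p q}

theorem Colour.code_le (c : Colour) : c.code ≤ 1 := by cases c <;> simp [Colour.code]

theorem Colour.code_inj {c d : Colour} (h : c.code = d.code) : c = d := by
  cases c <;> cases d <;> simp_all [Colour.code]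

/-! ### Decomposition of rectangles into halves and quadrants. -/

section Geometry

variable {m : ℕ} {S : Multiset Point}

theorem leafX_bounds {p : Point} (hp : p.InGrid m) :
    treeSize m ≤ leafX (treeSize m) p ∧ leafX (treeSize m) p < 2 * treeSize m := by
  have := lt_treeSize m
  have := p.colour.code_le
  have := hp.1.2
  unfold leafX
  omega

theorem leafY_bounds {p : Point} (hp : p.InGrid m) :
    treeSize m ≤ leafY (treeSize m) p ∧ leafY (treeSize m) p < 2 * treeSize m := by
  have := lt_treeSize m
  have := p.colour.code_le
  have := hp.2.2
  unfold leafY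
  omega

/-- The parity of a leaf offset is the colour, and half the offset is the coordinate. -/
theorem eq_of_leaf_eq {N : ℕ} {p q : Point} (hx : leafX N p = leafX N q)
    (hy : leafY N p = leafY N q) : p = q := by
  have := p.colour.code_le
  have := q.colour.code_le
  obtain ⟨c, x, y⟩ := p
  obtain ⟨d, x', y'⟩ := q
  simp only [leafX, leafY] at *
  rw [Point.mk.injEq]
  exact ⟨Colour.code_inj (by omega), by omega, by omega⟩

theorem x_le_of_under {a : ℕ} {p q : Point} (hp : p.InGrid m) (hq : q.InGrid m) (ha : 1 ≤ a)
    (h : Under (2 * a) (leafX (treeSize m) p)) (h' : Under (2 * a + 1) (leafX (treeSize m) q)) :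
    p.x ≤ q.x := by
  have h := lt_of_under ha (leafX_bounds hp).2 (leafX_bounds hq).1 h h'
  have := p.colour.code_le
  have := q.colour.code_le
  unfold leafX at h
  omega

theorem y_le_of_under {a : ℕ} {p q : Point} (hp : p.InGrid m) (hq : q.InGrid m) (ha : 1 ≤ a)
    (h : Under (2 * a) (leafY (treeSize m) p)) (h' : Under (2 * a + 1) (leafY (treeSize m) q)) :
    p.y ≤ q.y := by
  have h := lt_of_under ha (leafY_bounds hp).2 (leafY_bounds hq).1 h h'
  have := p.colour.code_le
  have := q.colour.code_le
  unfold leafY at h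
  omega

theorem keys_split_x (hS : ∀ p ∈ S, p.InGrid m) (c : Colour) (f : ℕ) {a : ℕ} (b : ℕ)
    (ha : a < treeSize m) :
    keys m S c f a b = keys m S c f (2 * a) b ∪ keys m S c f (2 * a + 1) b := by
  ext k
  constructor
  · rintro ⟨p, hp, hc, hx, hy, rfl⟩
    exact ((under_iff ha (leafX_bounds (hS p hp)).1).1 hx).imp
      (fun h => ⟨p, hp, hc, h, hy, rfl⟩) fun h => ⟨p, hp, hc, h, hy, rfl⟩
  · rintro (⟨p, hp, hc, hx, hy, rfl⟩ | ⟨p, hp, hc, hx, hy, rfl⟩)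
    · exact ⟨p, hp, hc, (under_iff ha (leafX_bounds (hS p hp)).1).2 (.inl hx), hy, rfl⟩
    · exact ⟨p, hp, hc, (under_iff ha (leafX_bounds (hS p hp)).1).2 (.inr hx), hy, rfl⟩

theorem keys_split_y (hS : ∀ p ∈ S, p.InGrid m) (c : Colour) (f a : ℕ) {b : ℕ}
    (hb : b < treeSize m) :
    keys m S c f a b = keys m S c f a (2 * b) ∪ keys m S c f a (2 * b + 1) := by
  ext k
  constructor
  · rintro ⟨p, hp, hc, hx, hy, rfl⟩
    exact ((under_iff hb (leafY_bounds (hS p hp)).1).1 hy).imp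
      (fun h => ⟨p, hp, hc, hx, h, rfl⟩) fun h => ⟨p, hp, hc, hx, h, rfl⟩
  · rintro (⟨p, hp, hc, hx, hy, rfl⟩ | ⟨p, hp, hc, hx, hy, rfl⟩)
    · exact ⟨p, hp, hc, hx, (under_iff hb (leafY_bounds (hS p hp)).1).2 (.inl hy), rfl⟩
    · exact ⟨p, hp, hc, hx, (under_iff hb (leafY_bounds (hS p hp)).1).2 (.inr hy), rfl⟩

theorem keys_leaf (hS : ∀ p ∈ S, p.InGrid m) {p : Point} (hp : p.InGrid m) (c : Colour) (f : ℕ) :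
    keys m S c f (leafX (treeSize m) p) (leafY (treeSize m) p) =
      if p ∈ S ∧ p.colour = c then {key (base m) f p} else ∅ := by
  have h : ∀ q ∈ S, Under (leafX (treeSize m) p) (leafX (treeSize m) q) →
      Under (leafY (treeSize m) p) (leafY (treeSize m) q) → p = q := fun q hq hx hy =>
    eq_of_leaf_eq ((under_leaf (leafX_bounds hp).1 (leafX_bounds (hS q hq)).2).1 hx)
      ((under_leaf (leafY_bounds hp).1 (leafY_bounds (hS q hq)).2).1 hy)
  ext k
  split_ifs with hc
  · constructor
    · rintro ⟨q, hq, hqc, hx, hy, rfl⟩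
      rw [h q hq hx hy]
      rfl
    · rintro rfl
      exact ⟨p, hc.1, hc.2, .refl _, .refl _, rfl⟩
  · simp only [Set.mem_empty_iff_false, iff_false]
    rintro ⟨q, hq, hqc, hx, hy, rfl⟩
    obtain rfl := h q hq hx hy
    exact hc ⟨hq, hqc⟩

/-- Red and blue leaf offsets have different parity, so one leaf carries one colour only. The
recursion for pairs thus stops as soon as either node is a leaf. -/
theorem pairs_leaf_x (hS : ∀ p ∈ S, p.InGrid m) {a : ℕ} (b : ℕ) (ha : treeSize m ≤ a) :
    pairs m S a b = ∅ := by
  ext k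
  simp only [Set.mem_empty_iff_false, iff_false]
  rintro ⟨p, q, ⟨hp, hq, hpc, hqc⟩, ⟨hx, -⟩, ⟨hx', -⟩, -⟩
  have h := ((under_leaf ha (leafX_bounds (hS p hp)).2).1 hx).symm.trans
    ((under_leaf ha (leafX_bounds (hS q hq)).2).1 hx')
  simp only [leafX, hpc, hqc, Colour.code] at h
  omega

theorem pairs_leaf_y (hS : ∀ p ∈ S, p.InGrid m) (a : ℕ) {b : ℕ} (hb : treeSize m ≤ b) :
    pairs m S a b = ∅ := by
  ext k
  simp only [Set.mem_empty_iff_false, iff_false]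
  rintro ⟨p, q, ⟨hp, hq, hpc, hqc⟩, ⟨-, hy⟩, ⟨-, hy'⟩, -⟩
  have h := ((under_leaf hb (leafY_bounds (hS p hp)).2).1 hy).symm.trans
    ((under_leaf hb (leafY_bounds (hS q hq)).2).1 hy')
  simp only [leafY, hpc, hqc, Colour.code] at h
  omega

/-- The reason for `Colour.scale`: the red coordinates fill the base-B digits 3 and 2, the blue ones
the digits 1 and 0, and the features add up in the digits from 4 on. -/
theorem key_add_key {B f g : ℕ} {p q : Point} (hp : p.colour = .red) (hq : q.colour = .blue)
    (h : feat f p + feat g q = pairValue p q) : key B f p + key B g q = pairKey B p q := by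
  simp only [key, pairKey, hp, hq, Colour.scale, ← h]
  ring

/-- A bichromatic pair in a rectangle lies in one of its halves, or in two opposite quadrants. -/
theorem pairs_split (hS : ∀ p ∈ S, p.InGrid m) {a b : ℕ} (ha : a < treeSize m)
    (hb : b < treeSize m) (ha1 : 1 ≤ a) (hb1 : 1 ≤ b) :
    pairs m S a b =
      pairs m S (2 * a) b ∪ pairs m S (2 * a + 1) b ∪ pairs m S a (2 * b) ∪
        pairs m S a (2 * b + 1) ∪
        sumset (keys m S .red 3 (2 * a) (2 * b)) (keys m S .blue 0 (2 * a + 1) (2 * b + 1)) ∪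
        sumset (keys m S .red 0 (2 * a + 1) (2 * b + 1)) (keys m S .blue 3 (2 * a) (2 * b)) ∪
        sumset (keys m S .red 1 (2 * a) (2 * b + 1)) (keys m S .blue 2 (2 * a + 1) (2 * b)) ∪
        sumset (keys m S .red 2 (2 * a + 1) (2 * b)) (keys m S .blue 1 (2 * a) (2 * b + 1)) := by
  have ux : ∀ p ∈ S, Under a (leafX (treeSize m) p) ↔ Under (2 * a) (leafX (treeSize m) p) ∨
      Under (2 * a + 1) (leafX (treeSize m) p) := fun p hp => under_iff ha (leafX_bounds (hS p hp)).1
  have uy : ∀ p ∈ S, Under b (leafY (treeSize m) p) ↔ Under (2 * b) (leafY (treeSize m) p) ∨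
      Under (2 * b + 1) (leafY (treeSize m) p) := fun p hp => under_iff hb (leafY_bounds (hS p hp)).1
  have lx : ∀ p ∈ S, ∀ q ∈ S, Under (2 * a) (leafX (treeSize m) p) →
      Under (2 * a + 1) (leafX (treeSize m) q) → p.x ≤ q.x := fun p hp q hq =>
    x_le_of_under (hS p hp) (hS q hq) ha1
  have ly : ∀ p ∈ S, ∀ q ∈ S, Under (2 * b) (leafY (treeSize m) p) →
      Under (2 * b + 1) (leafY (treeSize m) q) → p.y ≤ q.y := fun p hp q hq =>
    y_le_of_under (hS p hp) (hS q hq) hb1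
  ext k
  simp only [Set.mem_union]
  constructor
  · rintro ⟨p, q, hpq, ⟨hx, hy⟩, ⟨hx', hy'⟩, rfl⟩
    have hh := hpq
    obtain ⟨hp, hq, hpc, hqc⟩ := hh
    rcases (ux p hp).1 hx with h1 | h1 <;> rcases (ux q hq).1 hx' with h2 | h2
    · exact .inl <| .inl <| .inl <| .inl <| .inl <| .inl <| .inl
        ⟨p, q, hpq, ⟨h1, hy⟩, ⟨h2, hy'⟩, rfl⟩
    · rcases (uy p hp).1 hy with h3 | h3 <;> rcases (uy q hq).1 hy' with h4 | h4
      · exact .inl <| .inl <| .inl <| .inl <| .inl <| .inr ⟨p, q, hpq, ⟨hx, h3⟩, ⟨hx', h4⟩, rfl⟩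
      -- Opposite quadrants: here the red point is below and to the left, so it supplies both
      -- minima, and the blue one contributes the feature 0.
      · refine .inl <| .inl <| .inl <| .inr ⟨_, ⟨p, hp, hpc, h1, h3, rfl⟩, _,
          ⟨q, hq, hqc, h2, h4, rfl⟩, (key_add_key hpc hqc ?_).symm⟩
        have := lx p hp q hq h1 h2
        have := ly p hp q hq h3 h4
        simp only [feat, pairValue]
        omega
      · refine .inl <| .inr ⟨_, ⟨p, hp, hpc, h1, h3, rfl⟩, _,
          ⟨q, hq, hqc, h2, h4, rfl⟩, (key_add_key hpc hqc ?_).symm⟩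
        have := lx p hp q hq h1 h2
        have := ly q hq p hp h4 h3
        simp only [feat, pairValue]
        omega
      · exact .inl <| .inl <| .inl <| .inl <| .inr ⟨p, q, hpq, ⟨hx, h3⟩, ⟨hx', h4⟩, rfl⟩
    · rcases (uy p hp).1 hy with h3 | h3 <;> rcases (uy q hq).1 hy' with h4 | h4
      · exact .inl <| .inl <| .inl <| .inl <| .inl <| .inr ⟨p, q, hpq, ⟨hx, h3⟩, ⟨hx', h4⟩, rfl⟩
      · refine .inr ⟨_, ⟨p, hp, hpc, h1, h3, rfl⟩, _,
          ⟨q, hq, hqc, h2, h4, rfl⟩, (key_add_key hpc hqc ?_).symm⟩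
        have := lx q hq p hp h2 h1
        have := ly p hp q hq h3 h4
        simp only [feat, pairValue]
        omega
      · refine .inl <| .inl <| .inr ⟨_, ⟨p, hp, hpc, h1, h3, rfl⟩, _,
          ⟨q, hq, hqc, h2, h4, rfl⟩, (key_add_key hpc hqc ?_).symm⟩
        have := lx q hq p hp h2 h1
        have := ly q hq p hp h4 h3
        simp only [feat, pairValue]
        omega
      · exact .inl <| .inl <| .inl <| .inl <| .inr ⟨p, q, hpq, ⟨hx, h3⟩, ⟨hx', h4⟩, rfl⟩
    · exact .inl <| .inl <| .inl <| .inl <| .inl <| .inl <| .inr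
        ⟨p, q, hpq, ⟨h1, hy⟩, ⟨h2, hy'⟩, rfl⟩
  -- The converse for the four sumsets at once: the quadrants lie in the rectangle, and `hv` is the
  -- splitting of the value.
  · have sep : ∀ {f g i j i' j'}, (∀ l, l = i ∨ l = i' → l = 2 * a ∨ l = 2 * a + 1) →
        (∀ l, l = j ∨ l = j' → l = 2 * b ∨ l = 2 * b + 1) →
        (∀ p ∈ S, ∀ q ∈ S, Under i (leafX (treeSize m) p) → Under i' (leafX (treeSize m) q) →
          Under j (leafY (treeSize m) p) → Under j' (leafY (treeSize m) q) →
          feat f p + feat g q = pairValue p q) →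
        k ∈ sumset (keys m S .red f i j) (keys m S .blue g i' j') → k ∈ pairs m S a b := by
      rintro f g i j i' j' hi hj hv ⟨_, ⟨p, hp, hpc, h1, h2, rfl⟩, _, ⟨q, hq, hqc, h3, h4, rfl⟩, rfl⟩
      refine ⟨p, q, ⟨hp, hq, hpc, hqc⟩, ⟨(ux p hp).2 ?_, (uy p hp).2 ?_⟩,
        ⟨(ux q hq).2 ?_, (uy q hq).2 ?_⟩, key_add_key hpc hqc (hv p hp q hq h1 h3 h2 h4)⟩
      · rcases hi i (.inl rfl) with rfl | rfl
        exacts [.inl h1, .inr h1]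
      · rcases hj j (.inl rfl) with rfl | rfl
        exacts [.inl h2, .inr h2]
      · rcases hi i' (.inr rfl) with rfl | rfl
        exacts [.inl h3, .inr h3]
      · rcases hj j' (.inr rfl) with rfl | rfl
        exacts [.inl h4, .inr h4]
    rintro (((((((⟨p, q, hpq, ⟨hx, hy⟩, ⟨hx', hy'⟩, rfl⟩ | ⟨p, q, hpq, ⟨hx, hy⟩, ⟨hx', hy'⟩, rfl⟩) |
      ⟨p, q, hpq, ⟨hx, hy⟩, ⟨hx', hy'⟩, rfl⟩) | ⟨p, q, hpq, ⟨hx, hy⟩, ⟨hx', hy'⟩, rfl⟩) | h) | h) |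
      h) | h)
    · exact ⟨p, q, hpq, ⟨(ux p hpq.1).2 (.inl hx), hy⟩, ⟨(ux q hpq.2.1).2 (.inl hx'), hy'⟩, rfl⟩
    · exact ⟨p, q, hpq, ⟨(ux p hpq.1).2 (.inr hx), hy⟩, ⟨(ux q hpq.2.1).2 (.inr hx'), hy'⟩, rfl⟩
    · exact ⟨p, q, hpq, ⟨hx, (uy p hpq.1).2 (.inl hy)⟩, ⟨hx', (uy q hpq.2.1).2 (.inl hy')⟩, rfl⟩
    · exact ⟨p, q, hpq, ⟨hx, (uy p hpq.1).2 (.inr hy)⟩, ⟨hx', (uy q hpq.2.1).2 (.inr hy')⟩, rfl⟩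
    · refine sep (by omega) (by omega) (fun p hp q hq h1 h2 h3 h4 => ?_) h
      have := lx p hp q hq h1 h2
      have := ly p hp q hq h3 h4
      simp only [feat, pairValue]
      omega
    · refine sep (by omega) (by omega) (fun p hp q hq h1 h2 h3 h4 => ?_) h
      have := lx q hq p hp h2 h1
      have := ly q hq p hp h4 h3
      simp only [feat, pairValue]
      omega
    · refine sep (by omega) (by omega) (fun p hp q hq h1 h2 h3 h4 => ?_) h
      have := lx p hp q hq h1 h2
      have := ly q hq p hp h4 h3
      simp only [feat, pairValue]
      omega
    · refine sep (by omega) (by omega) (fun p hp q hq h1 h2 h3 h4 => ?_) h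
      have := lx q hq p hp h2 h1
      have := ly p hp q hq h3 h4
      simp only [feat, pairValue]
      omega

/-! ### Sizes -/

theorem lt_base {p : Point} (hp : p.InGrid m) : p.x < base m ∧ p.y < base m := by
  have := lt_treeSize m
  have := hp.1.2
  have := hp.2.2
  unfold base
  omega

theorem pack_lt {p : Point} (hp : p.InGrid m) : pack (base m) p < base m ^ 2 := by
  obtain ⟨h1, h2⟩ := lt_base hp
  rw [pack, sq]
  calc p.x * base m + p.y < (p.x + 1) * base m := by rw [Nat.succ_mul]; omega
    _ ≤ _ := Nat.mul_le_mul_right _ h1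

theorem pack_pos {B : ℕ} {p : Point} (hp : p.InGrid m) : 0 < pack B p := by
  have := hp.2.1
  unfold pack
  omega

/-- For `m ≥ 2` the power of two `treeSize m` is at least 6, hence at least 8. The bound 16 lets the
record length 16 be absorbed by one factor `base m`. -/
theorem sixteen_le_base (hm : 2 ≤ m) : 16 ≤ base m := by
  have h := lt_treeSize m
  have h4 : 2 ^ 2 < 2 ^ Nat.clog 2 (2 * m + 2) := by
    change _ < treeSize m
    omega
  have h5 := Nat.pow_le_pow_right (n := 2) (by omega) ((Nat.pow_lt_pow_iff_right (by omega)).1 h4)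
  change _ ≤ treeSize m at h5
  unfold base
  omega

/-- The feature may be 0, so positivity comes from the packed coordinates, that is, from `1 ≤ p.y`.
-/
theorem key_pos {f : ℕ} {p : Point} (hp : p.InGrid m) : 0 < key (base m) f p := by
  have := lt_treeSize m
  have h : 0 < p.colour.scale (base m) := by
    cases p.colour
    · exact pow_pos (show 0 < base m by unfold base; omega) 2
    · exact Nat.one_pos
  have := Nat.mul_pos (pack_pos (B := base m) hp) h
  unfold key
  omega

theorem key_lt {f : ℕ} {p : Point} (hp : p.InGrid m) : key (base m) f p < base m ^ 5 := by
  have h0 := lt_treeSize m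
  have hB : 0 < base m := by unfold base; omega
  have h1 : pack (base m) p * p.colour.scale (base m) < base m ^ 4 := by
    have := pack_lt hp
    calc pack (base m) p * p.colour.scale (base m) < base m ^ 2 * base m ^ 2 := by
          refine Nat.mul_lt_mul_of_lt_of_le this ?_ (by positivity)
          cases p.colour
          · exact le_rfl
          · exact Nat.one_le_pow _ _ hB
      _ = _ := by ring
  have h2 : feat f p < base m := by
    have := hp.1.2
    have := hp.2.2
    unfold feat base
    split <;> omega
  unfold key
  calc feat f p * base m ^ 4 + pack (base m) p * p.colour.scale (base m)
      < (feat f p + 1) * base m ^ 4 := by rw [Nat.succ_mul]; omega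
    _ ≤ base m * base m ^ 4 := Nat.mul_le_mul_right _ h2
    _ = _ := by ring

end Geometry

/-! ### The program

Register `10` holds the number `N` of leaves, `11` the base `B = 2N`, `12` zero, `13` and `14` the
leaves of the updated point, `15` and `16` the current pair of nodes, `17` a bound. The memory has
`16` cells for every pair of nodes: cell `4c + f` holds the greatest key for colour `c` and feature
`f`, cell `8` the greatest key of a pair, and cell `9` of a pair of leaves the multiplicity of its
point. Register `20` holds the address of the current cells; registers from `21` on are scratch. -/

/-- Run programs one after the other. -/
def block : List Program → Program
  | [] => .skip
  | p :: l => .seq p (block l)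

/-- The address of cell `j` of a pair of nodes. -/
def addr (B a b j : ℕ) : ℕ := (a * B + b) * 16 + j

/-- The address of the cells of a pair of nodes, as an expression. -/
@[simp] def cellE (a b : Expr) : Expr := .mul (.add (.mul a (.var 11)) b) (.const 16)

/-- The left child of a node. -/
@[simp] def leftE (i : ℕ) : Expr := .mul (.const 2) (.var i)

/-- The right child of a node. -/
@[simp] def rightE (i : ℕ) : Expr := .add (.mul (.const 2) (.var i)) (.const 1)

/-- Cell `j` of the cells whose address is in register `i`. -/
@[simp] def fieldE (i j : ℕ) : Expr := .add (.var i) (.const j)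

/-- Replace register `d` by its maximum with register `a`. -/
def keepMax (d a : ℕ) : Program := .ite (.lt d a) (assign d (.var a)) .skip

/-- Set the first `n` current cells to the maxima of those at registers `21` and `22`. -/
def mergeUpTo : ℕ → Program
  | 0 => .skip
  | j + 1 => .seq (mergeUpTo j) (block [fetch 23 (fieldE 21 j), fetch 24 (fieldE 22 j),
      keepMax 23 24, write (fieldE 20 j) 23])

/-- Set the current cells to the maxima of the cells of two pairs of nodes. -/
def merge (a b a' b' : Expr) : Program :=
  block [assign 21 (cellE a b), assign 22 (cellE a' b'), mergeUpTo 9]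

/-- Take a pair key in memory into account in register `25`. -/
def keepCell (a b : Expr) : Program :=
  block [fetch 23 (.add (cellE a b) (.const 8)), keepMax 25 23]

/-- Take the sum of a red key and a blue key into account in register `25`. -/
def keepSum (a b : Expr) (j : ℕ) (a' b' : Expr) (j' : ℕ) : Program :=
  block [fetch 23 (.add (cellE a b) (.const j)), fetch 24 (.add (cellE a' b') (.const j')),
    .ite (.eq 23 12) .skip (.ite (.eq 24 12) .skip
      (block [assign 23 (.add (.var 23) (.var 24)), keepMax 25 23]))]

/-- Take the halves in the second direction and the quadrants into account in cell `8`. -/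
def best : Program :=
  block [fetch 25 (fieldE 20 8), keepCell (.var 15) (leftE 16), keepCell (.var 15) (rightE 16),
    keepSum (leftE 15) (leftE 16) 3 (rightE 15) (rightE 16) 4,
    keepSum (rightE 15) (rightE 16) 0 (leftE 15) (leftE 16) 7,
    keepSum (leftE 15) (rightE 16) 1 (rightE 15) (leftE 16) 6,
    keepSum (rightE 15) (leftE 16) 2 (leftE 15) (rightE 16) 5,
    write (fieldE 20 8) 25]

/-- Set the first `n` current cells to zero. -/
def clearUpTo : ℕ → Program
  | 0 => .skip
  | j + 1 => .seq (clearUpTo j) (write (fieldE 20 j) 12)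

/-- A feature of the updated point. -/
@[simp] def featE : ℕ → Expr
  | 0 => .const 0
  | 1 => .var 3
  | 2 => .var 4
  | _ => .add (.var 3) (.var 4)

/-- The factor `Colour.scale`. -/
@[simp] def scaleE : Colour → Expr
  | .red => .mul (.var 11) (.var 11)
  | .blue => .const 1

/-- A key of the updated point. -/
@[simp] def keyE (c : Colour) (f : ℕ) : Expr :=
  .add (.mul (featE f) (.mul (.mul (.var 11) (.var 11)) (.mul (.var 11) (.var 11))))
    (.mul (.add (.mul (.var 3) (.var 11)) (.var 4)) (scaleE c))

/-- Write the first `n` keys of the updated point into the current cells. -/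
def writeKeys (c : Colour) : ℕ → Program
  | 0 => .skip
  | f + 1 => .seq (writeKeys c f)
      (block [assign 24 (keyE c f), write (fieldE 20 (4 * c.code + f)) 24])

/-- Recompute the cells of the pair of leaves of the updated point. -/
def leaf : Program :=
  block [clearUpTo 9, fetch 23 (fieldE 20 9), .ite (.eq 23 12) .skip
    (.ite (.eq 2 12) (writeKeys .red 4) (writeKeys .blue 4))]

/-- Recompute the cells of the current pair of nodes. -/
def node : Program :=
  block [assign 20 (cellE (.var 15) (.var 16)),
    .ite (.lt 15 10)
      (block [merge (leftE 15) (.var 16) (rightE 15) (.var 16), .ite (.lt 16 10) best .skip])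
      (.ite (.lt 16 10) (merge (.var 15) (leftE 16) (.var 15) (rightE 16)) leaf)]

/-- Compute the size of the trees. -/
def prepare : Program :=
  .seq (block [assign 12 (.const 0), assign 10 (.const 1),
      assign 17 (.add (.mul (.const 2) (.var 0)) (.const 2))])
    (.loop (.lt 10 17) (assign 10 (.add (.var 10) (.var 10))))

/-- Find the leaves of the updated point and update its multiplicity. -/
def count : Program :=
  block [assign 11 (.mul (.const 2) (.var 10)),
    assign 13 (.add (.var 10) (.add (.add (.var 3) (.var 3)) (.var 2))),
    assign 14 (.add (.var 10) (.add (.add (.var 4) (.var 4)) (.var 2))),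
    assign 20 (cellE (.var 13) (.var 14)), fetch 23 (fieldE 20 9), assign 24 (.const 1),
    .ite (.eq 1 12) (assign 23 (.add (.var 23) (.var 24))) (.instr (.op .sub 23 23 24)),
    write (fieldE 20 9) 23, assign 15 (.var 13)]

/-- Recompute the cells of all pairs of ancestors, from the leaves up. -/
def climb : Program :=
  .loop (.lt 12 15) (.seq (assign 16 (.var 14))
    (.seq (.loop (.lt 12 16) (block [node, assign 16 (.div (.var 16) (.const 2))]))
      (assign 15 (.div (.var 15) (.const 2)))))

/-- Unpack the key of the best pair. -/
def answer : Program :=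
  block [assign 15 (.const 1), fetch 5 (.add (cellE (.var 15) (.var 15)) (.const 8)),
    assign 6 (.mod (.div (.var 5) (.mul (.var 11) (.mul (.var 11) (.var 11)))) (.var 11)),
    assign 7 (.mod (.div (.var 5) (.mul (.var 11) (.var 11))) (.var 11)),
    assign 8 (.mod (.div (.var 5) (.var 11)) (.var 11)),
    assign 9 (.mod (.var 5) (.var 11))]

/-- The data structure: process one update. -/
def process : Program := .seq prepare (.seq count (.seq climb answer))

/-! ### Its parts -/

section Parts

variable {w : ℕ} {s : NState} {Q : NState → Prop}

theorem Halts.nil (h : Q s) : Halts w (block []) s Q := Halts.skip h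

theorem Halts.cons {p : Program} {l : List Program}
    (h : Halts w p s fun s' => Halts w (block l) s' Q) : Halts w (block (p :: l)) s Q := Halts.seq h

theorem Halts.keepMax {d a : ℕ} (hd : d < 30) (ha : a < 30)
    (h : Q (s.set d (max (s.r d) (s.r a)))) : Halts w (keepMax d a) s Q := by
  refine .ite_lt hd ha (fun hl => .assign ha ?_) fun hl => .skip ?_
  · rwa [max_eq_right hl.le] at h
  · rwa [max_eq_left hl, NState.set_self] at h

theorem addr_inj {B a b a' b' i j : ℕ} (hb : b < B) (hb' : b' < B) (hi : i < 16) (hj : j < 16)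
    (h : addr B a b i = addr B a' b' j) : a = a' ∧ b = b' ∧ i = j := by
  unfold addr at h
  have h1 : a * B + b = a' * B + b' := by omega
  have h2 : (a * B + b) / B = (a' * B + b') / B := by rw [h1]
  rw [Nat.add_div_of_dvd_right ⟨a, mul_comm _ _⟩, Nat.add_div_of_dvd_right ⟨a', mul_comm _ _⟩,
    Nat.mul_div_cancel _ (by omega), Nat.mul_div_cancel _ (by omega), Nat.div_eq_of_lt hb,
    Nat.div_eq_of_lt hb'] at h2
  simp only [add_zero] at h2
  subst h2
  omega

theorem mergeUpTo_spec {c c₁ c₂ : ℕ} (h0 : s.r 20 = c * 16) (h1 : s.r 21 = c₁ * 16)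
    (h2 : s.r 22 = c₂ * 16) (b0 : c * 16 + 16 < 2 ^ w)
    (b1 : c₁ * 16 + 16 < 2 ^ w) (b2 : c₂ * 16 + 16 < 2 ^ w) : ∀ n ≤ 9,
    Halts w (mergeUpTo n) s fun s' => (∀ i, i ≠ 23 → i ≠ 24 → s'.r i = s.r i) ∧
      (∀ j < n, s'.M (c * 16 + j) = max (s.M (c₁ * 16 + j)) (s.M (c₂ * 16 + j))) ∧
      ∀ a, (∀ j < n, a ≠ c * 16 + j) → s'.M a = s.M a := by
  intro n
  induction n with
  | zero => exact fun _ => .skip ⟨fun _ _ _ => rfl, by simp, fun _ _ => rfl⟩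
  | succ n ih =>
    intro hn
    refine .seq ((ih (by omega)).mono fun s₁ ⟨hr, hM, hM'⟩ => ?_)
    have e0 : s₁.r 20 = c * 16 := by rw [hr 20 (by omega) (by omega), h0]
    have e1 : s₁.r 21 = c₁ * 16 := by rw [hr 21 (by omega) (by omega), h1]
    have e2 : s₁.r 22 = c₂ * 16 := by rw [hr 22 (by omega) (by omega), h2]
    refine .cons (.fetch (by simp [e1]; omega) (.cons (.fetch (by simp [e2]; omega) (.cons
      (.keepMax (by omega) (by omega) (.cons (.write (by simp [e0]; omega) (by omega)
        (.nil ⟨?_, ?_, ?_⟩))))))))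
    · intro i h23 h24
      simp [h23, h24, hr i h23 h24]
    · intro j hj
      rcases Nat.lt_succ_iff_lt_or_eq.1 hj with hj | rfl
      · simp [e0, hM j hj, hj.ne]
      · simp [e0, e1, e2]
        -- The source cells with index `j` are still unchanged: the cells written so far have a
        -- smaller index modulo 16.
        rw [hM' _ (by omega), hM' _ (by omega)]
    · intro a ha
      have := ha n (by omega)
      simp [e0, this]
      exact hM' a fun j hj => ha j (by omega)

theorem clearUpTo_spec {c : ℕ} (h0 : s.r 20 = c * 16) (hz : s.r 12 = 0)
    (b0 : c * 16 + 16 < 2 ^ w) : ∀ n ≤ 9,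
    Halts w (clearUpTo n) s fun s' => s'.r = s.r ∧ (∀ j < n, s'.M (c * 16 + j) = 0) ∧
      ∀ a, (∀ j < n, a ≠ c * 16 + j) → s'.M a = s.M a := by
  intro n
  induction n with
  | zero => exact fun _ => .skip ⟨rfl, by simp, fun _ _ => rfl⟩
  | succ n ih =>
    intro hn
    refine .seq ((ih (by omega)).mono fun s₁ ⟨hr, hM, hM'⟩ => ?_)
    refine .write (by simp [hr, h0]; omega) (by omega) ⟨hr, fun j hj => ?_, fun a ha => ?_⟩
    · rcases Nat.lt_succ_iff_lt_or_eq.1 hj with hj | rfl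
      · simp [hr, h0, hM j hj, hj.ne]
      · simp [hr, h0, hz]
    · have := ha n (by omega)
      simp [hr, h0, this]
      exact hM' a fun j hj => ha j (by omega)

theorem writeKeys_spec {B c : ℕ} {p : Point} (hB : 16 ≤ B) (hW : B ^ 16 ≤ 2 ^ w)
    (hx : p.x < B) (hy : p.y < B) (h3 : s.r 3 = p.x) (h4 : s.r 4 = p.y) (h11 : s.r 11 = B)
    (h0 : s.r 20 = c * 16) (b0 : c * 16 + 16 < 2 ^ w) : ∀ n ≤ 4,
    Halts w (writeKeys p.colour n) s fun s' => (∀ i, i ≠ 24 → s'.r i = s.r i) ∧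
      (∀ f < n, s'.M (c * 16 + (4 * p.colour.code + f)) = key B f p) ∧
      ∀ a, (∀ f < n, a ≠ c * 16 + (4 * p.colour.code + f)) → s'.M a = s.M a := by
  intro n
  have hBB : B < B ^ 2 := by
    rw [sq]
    nlinarith
  induction n with
  | zero => exact fun _ => .skip ⟨fun _ _ => rfl, by simp, fun _ _ => rfl⟩
  | succ n ih =>
    intro hn
    have hc := p.colour.code_le
    refine .seq ((ih (by omega)).mono fun s₁ ⟨hr, hM, hM'⟩ => ?_)
    have e3 : s₁.r 3 = p.x := by rw [hr 3 (by omega), h3]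
    have e4 : s₁.r 4 = p.y := by rw [hr 4 (by omega), h4]
    have e11 : s₁.r 11 = B := by rw [hr 11 (by omega), h11]
    have e20 : s₁.r 20 = c * 16 := by rw [hr 20 (by omega), h0]
    have hv : (keyE p.colour n).eval s₁ = key B n p := by
      have hf : (featE n).eval s₁ = feat n p := by
        unfold featE feat
        split <;> simp [e3, e4]
      have hs : (scaleE p.colour).eval s₁ = p.colour.scale B := by
        cases p.colour <;> simp [e11, Colour.scale, sq]
      simp only [keyE, Expr.eval, hf, hs, e3, e4, e11, key, pack]
      ring
    -- The key has degree at most 12, within the 16 granted by `hW`.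
    have hsafe : (keyE p.colour n).Safe (2 ^ w) s₁ := by
      refine (Expr.safe_of_vars (B := B) (by omega) s₁ _ (fun i hi => ?_)
        (le_trans (Nat.pow_le_pow_right (by omega) ?_) hW)).1
      · have : i = 3 ∨ i = 4 ∨ i = 11 := by
          have hn' : n = 0 ∨ n = 1 ∨ n = 2 ∨ n = 3 := by omega
          rcases hn' with rfl | rfl | rfl | rfl <;> generalize p.colour = c at hi <;> cases c <;>
            simp at hi <;> omega
        rcases this with rfl | rfl | rfl <;> omega
      · have hn' : n = 0 ∨ n = 1 ∨ n = 2 ∨ n = 3 := by omega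
        rcases hn' with rfl | rfl | rfl | rfl <;> generalize p.colour = c <;> cases c <;> decide
    refine .cons (.assign hsafe (.cons (.write (by simp [e20]; omega) (by omega)
      (.nil ⟨fun i hi => ?_, fun f hf => ?_, fun a ha => ?_⟩))))
    · simp [hi, hr i hi]
    · rw [hv]
      rcases Nat.lt_succ_iff_lt_or_eq.1 hf with hf | rfl
      · simp [e20, hM f hf, hf.ne]
      · simp [e20]
    · have := ha n (by omega)
      simp [e20, this]
      exact hM' a fun j hj => ha j (by omega)

theorem keepCell_spec {a b : Expr} (he : (Expr.add (cellE a b) (.const 8)).Safe (2 ^ w) s) :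
    Halts w (keepCell a b) s fun s' => (∀ i < 23, s'.r i = s.r i) ∧ s'.M = s.M ∧
      s'.r 25 = max (s.r 25) (s.M (addr (s.r 11) (a.eval s) (b.eval s) 8)) := by
  refine .cons (.fetch he (.cons (.keepMax (by omega) (by omega) (.nil ⟨fun i hi => ?_, rfl, ?_⟩))))
  · simp [show i ≠ 23 by omega, show i ≠ 25 by omega]
  · simp [addr]

/-- The second address is evaluated after register 23 has received the first key; hence the
hypotheses on it for every content `t` of that register. -/
theorem keepSum_spec {a b a' b' : Expr} {j j' : ℕ} (hz : s.r 12 = 0)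
    (he : (Expr.add (cellE a b) (.const j)).Safe (2 ^ w) s)
    (he' : ∀ t, (Expr.add (cellE a' b') (.const j')).Safe (2 ^ w) (s.set 23 t))
    (hv : ∀ t, a'.eval (s.set 23 t) = a'.eval s ∧ b'.eval (s.set 23 t) = b'.eval s)
    (hs : s.M (addr (s.r 11) (a.eval s) (b.eval s) j) +
      s.M (addr (s.r 11) (a'.eval s) (b'.eval s) j') < 2 ^ w) :
    Halts w (keepSum a b j a' b' j') s fun s' => (∀ i < 23, s'.r i = s.r i) ∧ s'.M = s.M ∧
      s'.r 25 = max (s.r 25) (pairSum (s.M (addr (s.r 11) (a.eval s) (b.eval s) j))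
        (s.M (addr (s.r 11) (a'.eval s) (b'.eval s) j'))) := by
  refine .cons (.fetch he (.cons (.fetch (he' _) (.cons ?_))))
  set A := s.M (addr (s.r 11) (a.eval s) (b.eval s) j) with hA
  have eA : s.M ((Expr.add (cellE a b) (.const j)).eval s) = A := rfl
  rw [eA]
  set A' := s.M (addr (s.r 11) (a'.eval s) (b'.eval s) j') with hA'
  have eA' : (s.set 23 A).M ((Expr.add (cellE a' b') (.const j')).eval (s.set 23 A)) = A' := by
    simp only [cellE, Expr.eval, (hv A).1, (hv A).2]
    rfl
  rw [eA']
  refine .ite_eq (by omega) (by omega) (fun h1 => .skip (.nil ⟨fun i hi => ?_, rfl, ?_⟩)) fun h1 => ?_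
  · simp [show i ≠ 23 by omega, show i ≠ 24 by omega]
  · have h0 : A = 0 := by simpa [hz] using h1
    simp [pairSum, h0]
  refine .ite_eq (by omega) (by omega) (fun h2 => .skip (.nil ⟨fun i hi => ?_, rfl, ?_⟩)) fun h2 => ?_
  · simp [show i ≠ 23 by omega, show i ≠ 24 by omega]
  · have h0 : A' = 0 := by simpa [hz] using h2
    simp [pairSum, h0]
  have n1 : A ≠ 0 := by simpa [hz] using h1
  have n2 : A' ≠ 0 := by simpa [hz] using h2
  refine .cons (.assign (by simpa using hs) (.cons (.keepMax (by omega) (by omega)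
    (.nil (.nil ⟨fun i hi => ?_, rfl, ?_⟩)))))
  · simp [show i ≠ 23 by omega, show i ≠ 24 by omega, show i ≠ 25 by omega]
  · simp [pairSum, n1, n2]

end Parts

/-! ### Recomputing the cells of one pair of nodes -/

/-- The cells of the pair of nodes `a`, `b` are right for `S`. -/
structure Good (m : ℕ) (S : Multiset Point) (M : ℕ → ℕ) (a b : ℕ) : Prop where
  keys : ∀ c, ∀ f < 4, Top (keys m S c f a b) (M (addr (base m) a b (4 * c.code + f)))
  pairs : Top (pairs m S a b) (M (addr (base m) a b 8))

section Node

variable {w m : ℕ} {s : NState} {S : Multiset Point}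

theorem Good.key_lt {M : ℕ → ℕ} {a b f : ℕ} (h : Good m S M a b) (hS : ∀ p ∈ S, p.InGrid m)
    (hm : 2 ≤ m) (c : Colour) (hf : f < 4) :
    M (addr (base m) a b (4 * c.code + f)) < base m ^ 5 := by
  have hB := sixteen_le_base hm
  by_cases h0 : M (addr (base m) a b (4 * c.code + f)) = 0
  · rw [h0]
    positivity
  · obtain ⟨p, hp, -, -, -, e⟩ := (h.keys c f hf).2 h0
    rw [e]
    exact BichromaticPoint.key_lt (hS p hp)

theorem keys_pos {c : Colour} {f a b : ℕ} (hS : ∀ p ∈ S, p.InGrid m) :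
    ∀ k ∈ keys m S c f a b, 0 < k := by
  rintro _ ⟨p, hp, -, -, -, rfl⟩
  exact key_pos (hS p hp)

theorem Good.congr {M M' : ℕ → ℕ} {a b : ℕ} (h : Good m S M a b)
    (hM : ∀ j < 9, M' (addr (base m) a b j) = M (addr (base m) a b j)) : Good m S M' a b := by
  refine ⟨fun c f hf => ?_, ?_⟩
  · have := c.code_le
    rw [hM _ (by omega)]
    exact h.keys c f hf
  · rw [hM _ (by omega)]
    exact h.pairs

theorem addr_lt {B a b : ℕ} (hB : 16 ≤ B) (hW : B ^ 16 ≤ 2 ^ w) (ha : a < B) (hb : b < B) :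
    (a * B + b) * 16 + 16 < 2 ^ w := by
  have h1 : a * B + b + 1 ≤ B * B := by
    calc a * B + b + 1 ≤ (a + 1) * B := by rw [Nat.succ_mul]; omega
      _ ≤ _ := Nat.mul_le_mul_right _ ha
  calc (a * B + b) * 16 + 16 = (a * B + b + 1) * 16 := by ring
    _ ≤ B * B * B := Nat.mul_le_mul h1 hB
    _ = B ^ 3 := by ring
    _ < B ^ 16 := Nat.pow_lt_pow_right (by omega) (by omega)
    _ ≤ _ := hW

theorem safe_of_node {B : ℕ} {e : Expr} (hB : 16 ≤ B) (hW : B ^ 16 ≤ 2 ^ w) (h11 : s.r 11 = B)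
    (h15 : s.r 15 < B) (h16 : s.r 16 < B) (hv : ∀ i ∈ e.vars, i = 11 ∨ i = 15 ∨ i = 16)
    (hd : e.deg ≤ 16) : e.Safe (2 ^ w) s := by
  have hBB : B < B ^ 2 := by
    rw [sq]
    nlinarith
  refine (Expr.safe_of_vars (B := B) (by omega) s e (fun i hi => ?_)
    (le_trans (Nat.pow_le_pow_right (by omega) hd) hW)).1
  rcases hv i hi with rfl | rfl | rfl <;> omega

theorem merge_spec {B c c₁ c₂ : ℕ} {a b a' b' : Expr} (h11 : s.r 11 = B) (h20 : s.r 20 = c * 16)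
    (e₁ : a.eval s * B + b.eval s = c₁)
    (e₂ : ∀ t, a'.eval (s.set 21 t) * B + b'.eval (s.set 21 t) = c₂)
    (s₁ : (cellE a b).Safe (2 ^ w) s) (s₂ : ∀ t, (cellE a' b').Safe (2 ^ w) (s.set 21 t))
    (b0 : c * 16 + 16 < 2 ^ w) (b1 : c₁ * 16 + 16 < 2 ^ w) (b2 : c₂ * 16 + 16 < 2 ^ w) :
    Halts w (merge a b a' b') s fun s' => (∀ i < 21, s'.r i = s.r i) ∧
      (∀ j < 9, s'.M (c * 16 + j) = max (s.M (c₁ * 16 + j)) (s.M (c₂ * 16 + j))) ∧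
      ∀ x, (∀ j < 9, x ≠ c * 16 + j) → s'.M x = s.M x := by
  refine .cons (.assign s₁ (.cons (.assign (s₂ _) (.cons
    ((mergeUpTo_spec (c := c) (c₁ := c₁) (c₂ := c₂) ?_ ?_ ?_ b0 b1 b2 9 le_rfl).mono
      fun s' ⟨hr, hM, hM'⟩ => .nil ⟨fun i hi => ?_, hM, hM'⟩)))))
  · simp [h20]
  · simp [h11, e₁]
  · have := e₂ ((cellE a b).eval s)
    simp only [cellE, Expr.eval, h11] at this
    simp [h11, this]
  · rw [hr i (by omega) (by omega)]
    simp [show i ≠ 22 by omega, show i ≠ 21 by omega]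

/-- The preceding merge has put the maximum over the two x-halves into cell 8 (`hx`); the remaining
six members of `pairs_split` are added here. All of them involve nodes that come later in the
lexicographic order of `hgood`. -/
theorem best_spec {v u : ℕ} (hm : 2 ≤ m) (hW : base m ^ 16 ≤ 2 ^ w) (hS : ∀ p ∈ S, p.InGrid m)
    (h11 : s.r 11 = base m) (h12 : s.r 12 = 0) (h15 : s.r 15 = v) (h16 : s.r 16 = u)
    (h20 : s.r 20 = (v * base m + u) * 16) (hv : v < treeSize m) (hu : u < treeSize m)
    (hv1 : 1 ≤ v) (hu1 : 1 ≤ u)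
    (hx : Top (pairs m S (2 * v) u ∪ pairs m S (2 * v + 1) u) (s.M (addr (base m) v u 8)))
    (hgood : ∀ a b, 1 ≤ a → a < base m → 1 ≤ b → b < base m → (v < a ∨ v = a ∧ u < b) →
      Good m S s.M a b) :
    Halts w best s fun s' => (∀ i < 21, s'.r i = s.r i) ∧
      Top (pairs m S v u) (s'.M (addr (base m) v u 8)) ∧
      ∀ x, x ≠ addr (base m) v u 8 → s'.M x = s.M x := by
  have hB := sixteen_le_base hm
  have hN : base m = 2 * treeSize m := rfl
  have g3 := hgood v (2 * u) (by omega) (by omega) (by omega) (by omega) (by omega)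
  have g4 := hgood v (2 * u + 1) (by omega) (by omega) (by omega) (by omega) (by omega)
  have q00 := hgood (2 * v) (2 * u) (by omega) (by omega) (by omega) (by omega) (by omega)
  have q01 := hgood (2 * v) (2 * u + 1) (by omega) (by omega) (by omega) (by omega) (by omega)
  have q10 := hgood (2 * v + 1) (2 * u) (by omega) (by omega) (by omega) (by omega) (by omega)
  have q11 := hgood (2 * v + 1) (2 * u + 1) (by omega) (by omega) (by omega) (by omega) (by omega)
  have hpow : base m ^ 5 + base m ^ 5 ≤ 2 ^ w := by
    calc base m ^ 5 + base m ^ 5 = 2 * base m ^ 5 := by ring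
      _ ≤ base m * base m ^ 5 := Nat.mul_le_mul_right _ (by omega)
      _ = base m ^ 6 := by ring
      _ ≤ base m ^ 16 := Nat.pow_le_pow_right (by omega) (by omega)
      _ ≤ _ := hW
  have safe : ∀ (e : Expr) (s' : NState), s'.r 11 = s.r 11 → s'.r 15 = s.r 15 → s'.r 16 = s.r 16 →
      (∀ i ∈ e.vars, i = 11 ∨ i = 15 ∨ i = 16) → e.deg ≤ 16 → e.Safe (2 ^ w) s' :=
    fun e s' k11 k15 k16 => safe_of_node hB hW (by omega) (by omega) (by omega)
  have b20 := addr_lt hB hW (show v < base m by omega) (show u < base m by omega)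
  have e20 : s.r 20 + 8 = addr (base m) v u 8 := by rw [h20, addr]
  -- Register 25 accumulates the maximum; `A` is the part of `pairs_split` treated so far.
  let K (A : Set ℕ) (s' : NState) : Prop :=
    (∀ i < 23, s'.r i = s.r i) ∧ s'.M = s.M ∧ Top A (s'.r 25)
  have cell : ∀ {a b : Expr} {A : Set ℕ} {a₀ b₀ : ℕ} {s₁ : NState}, K A s₁ →
      (∀ i ∈ (cellE a b).vars, i = 11 ∨ i = 15 ∨ i = 16) → (cellE a b).deg ≤ 14 →
      (∀ s' : NState, s'.r 15 = v → s'.r 16 = u → a.eval s' = a₀ ∧ b.eval s' = b₀) →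
      Good m S s.M a₀ b₀ → Halts w (keepCell a b) s₁ (K (A ∪ pairs m S a₀ b₀)) := by
    rintro a b A a₀ b₀ s₁ ⟨hr, hM, hT⟩ hv hd he hg
    obtain ⟨ea, eb⟩ := he s₁ (by rw [hr 15 (by omega), h15]) (by rw [hr 16 (by omega), h16])
    refine (keepCell_spec (safe _ _ (hr _ (by omega)) (hr _ (by omega)) (hr _ (by omega))
      (by simpa using hv) ?_)).mono fun s₂ ⟨hr₂, hM₂, h25⟩ => ⟨fun i hi => ?_, hM₂.trans hM, ?_⟩
    · have h4 : Nat.size 8 = 4 := by decide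
      rw [Expr.deg, Expr.deg, h4]
      omega
    · rw [hr₂ i hi, hr i hi]
    · rw [h25, ea, eb, hM, hr 11 (by omega), h11]
      exact hT.union hg.pairs
  have sum : ∀ {a b a' b' : Expr} {f f' : ℕ} {A : Set ℕ} {a₀ b₀ a₀' b₀' : ℕ} {s₁ : NState},
      K A s₁ → (∀ i ∈ (cellE a b).vars, i = 11 ∨ i = 15 ∨ i = 16) →
      (∀ i ∈ (cellE a' b').vars, i = 11 ∨ i = 15 ∨ i = 16) →
      (cellE a b).deg ≤ 14 → (cellE a' b').deg ≤ 14 → f < 4 → f' < 4 →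
      (∀ s' : NState, s'.r 15 = v → s'.r 16 = u → a.eval s' = a₀ ∧ b.eval s' = b₀) →
      (∀ s' : NState, s'.r 15 = v → s'.r 16 = u → a'.eval s' = a₀' ∧ b'.eval s' = b₀') →
      Good m S s.M a₀ b₀ → Good m S s.M a₀' b₀' →
      Halts w (keepSum a b f a' b' (4 + f')) s₁
        (K (A ∪ sumset (keys m S .red f a₀ b₀) (keys m S .blue f' a₀' b₀'))) := by
    rintro a b a' b' f f' A a₀ b₀ a₀' b₀' s₁ ⟨hr, hM, hT⟩ hv hv' hd hd' hf hf' he he' g g'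
    have r15 : s₁.r 15 = v := by rw [hr 15 (by omega), h15]
    have r16 : s₁.r 16 = u := by rw [hr 16 (by omega), h16]
    have r11 : s₁.r 11 = base m := by rw [hr 11 (by omega), h11]
    obtain ⟨ea, eb⟩ := he s₁ r15 r16
    obtain ⟨ea', eb'⟩ := he' s₁ r15 r16
    have k1 := g.keys .red f hf
    have k2 := g'.keys .blue f' hf'
    have l1 := g.key_lt hS hm .red hf
    have l2 := g'.key_lt hS hm .blue hf'
    simp only [Colour.code, mul_zero, zero_add, mul_one] at k1 k2 l1 l2
    have size : ∀ n ≤ 7, n.size ≤ 3 := by decide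
    refine (keepSum_spec ?_ (safe _ _ (hr _ (by omega)) (hr _ (by omega)) (hr _ (by omega))
      (by simpa using hv) ?_) (fun t => safe _ _ (hr _ (by omega)) (hr _ (by omega))
      (hr _ (by omega)) (by simpa using hv') ?_) (fun t => ?_) ?_).mono fun s₂ ⟨hr₂, hM₂, h25⟩ =>
        ⟨fun i hi => ?_, hM₂.trans hM, ?_⟩
    · rw [hr 12 (by omega), h12]
    · have := size f (by omega)
      rw [Expr.deg, Expr.deg]
      omega
    · have := size (4 + f') (by omega)
      rw [Expr.deg, Expr.deg]
      omega
    · rw [ea', eb']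
      exact he' _ r15 r16
    · rw [ea, eb, ea', eb', hM, r11]
      omega
    · rw [hr₂ i hi, hr i hi]
    · rw [h25, ea, eb, ea', eb', hM, r11]
      exact hT.union (k1.sumset k2 (keys_pos hS) (keys_pos hS))
  refine .cons (.fetch (by simp [h20]; omega) ?_)
  have K0 : K (pairs m S (2 * v) u ∪ pairs m S (2 * v + 1) u)
      (s.set 25 (s.M ((fieldE 20 8).eval s))) := by
    refine ⟨fun i hi => by simp [show i ≠ 25 by omega], rfl, ?_⟩
    simpa [e20] using hx
  refine .cons ((cell K0 (by decide) (by decide) (fun s' e e' => ⟨by simp [e], by simp [e']⟩) g3).mono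
    fun s₁ K₁ => ?_)
  refine .cons ((cell K₁ (by decide) (by decide) (fun s' e e' => ⟨by simp [e], by simp [e']⟩) g4).mono
    fun s₂ K₂ => ?_)
  refine .cons ((sum (f := 3) (f' := 0) K₂ (by decide) (by decide) (by decide) (by decide)
    (by omega) (by omega) (fun s' e e' => ⟨by simp [e], by simp [e']⟩)
    (fun s' e e' => ⟨by simp [e], by simp [e']⟩) q00 q11).mono fun s₃ K₃ => ?_)
  refine .cons ((sum (f := 0) (f' := 3) K₃ (by decide) (by decide) (by decide) (by decide)
    (by omega) (by omega) (fun s' e e' => ⟨by simp [e], by simp [e']⟩)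
    (fun s' e e' => ⟨by simp [e], by simp [e']⟩) q11 q00).mono fun s₄ K₄ => ?_)
  refine .cons ((sum (f := 1) (f' := 2) K₄ (by decide) (by decide) (by decide) (by decide)
    (by omega) (by omega) (fun s' e e' => ⟨by simp [e], by simp [e']⟩)
    (fun s' e e' => ⟨by simp [e], by simp [e']⟩) q01 q10).mono fun s₅ K₅ => ?_)
  refine .cons ((sum (f := 2) (f' := 1) K₅ (by decide) (by decide) (by decide) (by decide)
    (by omega) (by omega) (fun s' e e' => ⟨by simp [e], by simp [e']⟩)
    (fun s' e e' => ⟨by simp [e], by simp [e']⟩) q10 q01).mono fun s₆ ⟨hr, hM, hT⟩ => ?_)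
  have r20 := hr 20 (by omega)
  refine .cons (.write (by simp [r20, h20]; omega) (by omega)
    (.nil ⟨fun i hi => hr i (by omega), ?_, fun x hx => ?_⟩))
  · rw [pairs_split hS hv hu hv1 hu1]
    simpa [r20, e20] using hT
  · simp [r20, e20, hx, hM]

/-- Only `p` itself can lie in this rectangle, so the cells depend just on whether its multiplicity
is zero. -/
theorem leaf_spec {v u : ℕ} {p : Point} (hm : 2 ≤ m) (hW : base m ^ 16 ≤ 2 ^ w)
    (hS : ∀ p ∈ S, p.InGrid m) (hp : p.InGrid m) (h2 : s.r 2 = p.colour.code) (h3 : s.r 3 = p.x)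
    (h4 : s.r 4 = p.y) (h11 : s.r 11 = base m) (h12 : s.r 12 = 0)
    (h20 : s.r 20 = (v * base m + u) * 16) (hv : v = leafX (treeSize m) p)
    (hu : u = leafY (treeSize m) p) (hcount : s.M (addr (base m) v u 9) = S.count p) :
    Halts w leaf s fun s' => (∀ i < 21, s'.r i = s.r i) ∧ Good m S s'.M v u ∧
      ∀ x, (∀ j < 9, x ≠ addr (base m) v u j) → s'.M x = s.M x := by
  have hB := sixteen_le_base hm
  obtain ⟨lv, lv'⟩ := leafX_bounds hp
  obtain ⟨lu, lu'⟩ := leafY_bounds hp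
  rw [← hv] at lv lv'
  rw [← hu] at lu lu'
  have b20 := addr_lt hB hW (show v < base m from lv') (show u < base m from lu')
  have hk : ∀ c f, keys m S c f v u = if p ∈ S ∧ p.colour = c then {key (base m) f p} else ∅ := by
    rw [hv, hu]
    exact keys_leaf hS hp
  refine .cons ((clearUpTo_spec h20 h12 b20 9 le_rfl).mono fun s₁ ⟨hr, h0, hM⟩ => ?_)
  have e9 : s₁.M ((v * base m + u) * 16 + 9) = S.count p := by
    rw [hM _ (by omega)]
    exact hcount
  have b9 : (fieldE 20 9).Safe (2 ^ w) s₁ := by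
    simp [hr, h20]
    omega
  refine .cons (.fetch b9 (.cons ?_))
  simp only [fieldE, Expr.eval, hr, h20, e9]
  refine .ite_eq (by omega) (by omega) (fun hc => .skip (.nil ⟨?_, ⟨fun c f hf => ?_, ?_⟩, ?_⟩))
    fun hc => ?_
  · intro i hi
    simp [show i ≠ 23 by omega, hr]
  · have hc' : p ∉ S := by simpa [hr, h12] using hc
    have := c.code_le
    rw [hk, if_neg (by simp [hc']), addr, NState.set_M, h0 _ (by omega)]
    exact .empty
  · rw [pairs_leaf_x hS u lv, addr, NState.set_M, h0 _ (by omega)]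
    exact .empty
  · exact hM
  have hc' : p ∈ S := by simpa [hr, h12] using hc
  have main : Halts w (writeKeys p.colour 4) (s₁.set 23 (S.count p)) fun s' =>
      (∀ i < 21, s'.r i = s.r i) ∧ Good m S s'.M v u ∧
        ∀ x, (∀ j < 9, x ≠ addr (base m) v u j) → s'.M x = s.M x := by
    refine (writeKeys_spec hB hW (lt_base hp).1 (lt_base hp).2 (by simp [hr, h3]) (by simp [hr, h4])
      (by simp [hr, h11]) (by simp [hr, h20]) b20 4 le_rfl).mono fun s' ⟨hr', hk', hM'⟩ =>
        ⟨fun i hi => ?_, ⟨fun c f hf => ?_, ?_⟩, fun x hx => ?_⟩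
    · rw [hr' i (by omega)]
      simp [show i ≠ 23 by omega, hr]
    · rw [hk]
      have c1 := c.code_le
      have c2 := p.colour.code_le
      split_ifs with h
      · rw [← h.2, addr, hk' f hf]
        exact .singleton _
      · have : p.colour.code ≠ c.code := fun e => h ⟨hc', Colour.code_inj e⟩
        rw [addr, hM' _ (fun g hg => by omega), NState.set_M, h0 _ (by omega)]
        exact .empty
    · have c2 := p.colour.code_le
      rw [pairs_leaf_x hS u lv, addr, hM' _ (fun g hg => by omega), NState.set_M, h0 _ (by omega)]
      exact .empty
    · have c2 := p.colour.code_le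
      rw [hM' x fun g hg => hx _ (by omega)]
      exact hM x hx
  refine .ite_eq (by omega) (by omega) (fun h => ?_) fun h => ?_
  · have : p.colour = .red := by
      apply Colour.code_inj
      simpa [hr, h2, h12, Colour.code] using h
    rw [this] at main
    exact main.mono fun _ h => .nil h
  · have : p.colour = .blue := by
      cases hpc : p.colour
      · simp [hr, h2, h12, hpc, Colour.code] at h
      · rfl
    rw [this] at main
    exact main.mono fun _ h => .nil h

/-- Keys are merged along x while the x-node is inner, otherwise along y; pairs need the full
recursion only if both nodes are inner. In every case the cells read belong to pairs that come
lexicographically after `(v, u)`. -/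
theorem node_spec {v u : ℕ} {p : Point} (hm : 2 ≤ m) (hW : base m ^ 16 ≤ 2 ^ w)
    (hS : ∀ p ∈ S, p.InGrid m) (hp : p.InGrid m) (h2 : s.r 2 = p.colour.code) (h3 : s.r 3 = p.x)
    (h4 : s.r 4 = p.y) (h10 : s.r 10 = treeSize m) (h11 : s.r 11 = base m) (h12 : s.r 12 = 0)
    (h15 : s.r 15 = v) (h16 : s.r 16 = u) (hv1 : 1 ≤ v) (hu1 : 1 ≤ u)
    (hv : Under v (leafX (treeSize m) p)) (hu : Under u (leafY (treeSize m) p))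
    (hcount : s.M (addr (base m) (leafX (treeSize m) p) (leafY (treeSize m) p) 9) = S.count p)
    (hgood : ∀ a b, 1 ≤ a → a < base m → 1 ≤ b → b < base m → (v < a ∨ v = a ∧ u < b) →
      Good m S s.M a b) :
    Halts w node s fun s' => (∀ i < 20, s'.r i = s.r i) ∧ Good m S s'.M v u ∧
      ∀ x, (∀ j < 9, x ≠ addr (base m) v u j) → s'.M x = s.M x := by
  have hB := sixteen_le_base hm
  have hN : base m = 2 * treeSize m := rfl
  have hvB : v < base m := hv.le.trans_lt (leafX_bounds hp).2
  have huB : u < base m := hu.le.trans_lt (leafY_bounds hp).2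
  have safe : ∀ (e : Expr) (s' : NState), s'.r 11 = s.r 11 → s'.r 15 = s.r 15 → s'.r 16 = s.r 16 →
      (∀ i ∈ e.vars, i = 11 ∨ i = 15 ∨ i = 16) → e.deg ≤ 16 → e.Safe (2 ^ w) s' :=
    fun e s' k11 k15 k16 => safe_of_node hB hW (by omega) (by omega) (by omega)
  have b0 := addr_lt hB hW hvB huB
  refine .cons (.assign (safe _ _ rfl rfl rfl (by decide) (by decide)) (.cons ?_))
  simp only [cellE, Expr.eval, h15, h16, h11]
  refine .ite_lt (by omega) (by omega) (fun hvN => ?_) fun hvN => .ite_lt (by omega) (by omega)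
    (fun huN => ?_) fun huN => ?_
  · replace hvN : v < treeSize m := by simpa [h15, h10] using hvN
    have g1 := hgood (2 * v) u (by omega) (by omega) hu1 huB (by omega)
    have g2 := hgood (2 * v + 1) u (by omega) (by omega) hu1 huB (by omega)
    refine .cons ((merge_spec (B := base m) (c := v * base m + u) (c₁ := 2 * v * base m + u)
      (c₂ := (2 * v + 1) * base m + u) (by simp [h11]) (by simp) (by simp [h15, h16])
      (by simp [h15, h16])
      (safe _ _ (by simp) (by simp) (by simp) (by decide) (by decide))
      (fun t => safe _ _ (by simp) (by simp) (by simp) (by decide) (by decide)) b0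
      (addr_lt hB hW (by omega) huB) (addr_lt hB hW (by omega) huB)).mono
      fun s₁ ⟨hr, hM, hM'⟩ => ?_)
    have hk : ∀ c, ∀ f < 4, Top (keys m S c f v u) (s₁.M (addr (base m) v u (4 * c.code + f))) := by
      intro c f hf
      have := c.code_le
      rw [keys_split_x hS c f u hvN, addr, hM _ (by omega)]
      exact (g1.keys c f hf).union (g2.keys c f hf)
    have hb : Top (pairs m S (2 * v) u ∪ pairs m S (2 * v + 1) u) (s₁.M (addr (base m) v u 8)) := by
      rw [addr, hM _ (by omega)]
      exact g1.pairs.union g2.pairs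
    have hgood₁ : ∀ a b, 1 ≤ a → a < base m → 1 ≤ b → b < base m → (v < a ∨ v = a ∧ u < b) →
        Good m S s₁.M a b := fun a b a1 aB b1 bB hab =>
      (hgood a b a1 aB b1 bB hab).congr fun j hj => hM' _ fun i hi e => by
        have := addr_inj bB huB (by omega) (by omega) e
        omega
    refine .cons (.ite_lt (by omega) (by omega) (fun huN => ?_) fun huN => .skip (.nil (.nil
      ⟨fun i hi => ?_, ⟨hk, ?_⟩, hM'⟩)))
    · replace huN : u < treeSize m := by simpa [hr, h16, h10] using huN
      refine (best_spec (v := v) (u := u) hm hW hS (by simp [hr, h11]) (by simp [hr, h12])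
        (by simp [hr, h15]) (by simp [hr, h16]) (by simp [hr]) hvN huN hv1 hu1 hb hgood₁).mono
        fun s₂ ⟨hr₂, hT, hM₂⟩ => .nil (.nil ⟨fun i hi => ?_, ⟨fun c f hf => ?_, hT⟩, fun x hx => ?_⟩)
      · rw [hr₂ i (by omega), hr i (by omega)]
        simp [show i ≠ 20 by omega]
      · have := c.code_le
        rw [hM₂ _ fun e => by unfold addr at e; omega]
        exact hk c f hf
      · rw [hM₂ x (hx 8 (by omega))]
        exact hM' x hx
    · rw [hr i (by omega)]
      simp [show i ≠ 20 by omega]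
    · replace huN : treeSize m ≤ u := by simpa [hr, h16, h10] using huN
      rw [pairs_leaf_y hS _ huN, pairs_leaf_y hS _ huN, Set.union_self] at hb
      rwa [pairs_leaf_y hS _ huN]
  · replace hvN : treeSize m ≤ v := by simpa [h15, h10] using hvN
    replace huN : u < treeSize m := by simpa [h16, h10] using huN
    have g1 := hgood v (2 * u) (by omega) (by omega) (by omega) (by omega) (by omega)
    have g2 := hgood v (2 * u + 1) (by omega) (by omega) (by omega) (by omega) (by omega)
    refine (merge_spec (B := base m) (c := v * base m + u) (c₁ := v * base m + 2 * u)
      (c₂ := v * base m + (2 * u + 1)) (by simp [h11]) (by simp) (by simp [h15, h16])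
      (by simp [h15, h16])
      (safe _ _ (by simp) (by simp) (by simp) (by decide) (by decide))
      (fun t => safe _ _ (by simp) (by simp) (by simp) (by decide) (by decide)) b0
      (addr_lt hB hW hvB (by omega)) (addr_lt hB hW hvB (by omega))).mono
      fun s₁ ⟨hr, hM, hM'⟩ => .nil ⟨fun i hi => ?_, ⟨fun c f hf => ?_, ?_⟩, hM'⟩
    · rw [hr i (by omega)]
      simp [show i ≠ 20 by omega]
    · have := c.code_le
      rw [keys_split_y hS c f v huN, addr, hM _ (by omega)]
      exact (g1.keys c f hf).union (g2.keys c f hf)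
    · have hb := g1.pairs.union g2.pairs
      rw [pairs_leaf_x hS _ hvN, pairs_leaf_x hS _ hvN, Set.union_self] at hb
      rw [pairs_leaf_x hS _ hvN, addr, hM _ (by omega)]
      exact hb
  · replace hvN : treeSize m ≤ v := by simpa [h15, h10] using hvN
    replace huN : treeSize m ≤ u := by simpa [h16, h10] using huN
    have ev := (under_leaf hvN (leafX_bounds hp).2).1 hv
    have eu := (under_leaf huN (leafY_bounds hp).2).1 hu
    refine (leaf_spec (v := v) (u := u) hm hW hS hp (by simp [h2]) (by simp [h3]) (by simp [h4])
      (by simp [h11]) (by simp [h12]) (by simp) ev eu (by rw [ev, eu]; exact hcount)).mono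
      fun s₁ ⟨hr, hg, hM⟩ => .nil ⟨fun i hi => ?_, hg, hM⟩
    rw [hr i (by omega)]
    simp [show i ≠ 20 by omega]

end Node

/-! ### Processing one update -/

/-- The multiplicities of the points are stored. -/
def Counts (m : ℕ) (S : Multiset Point) (M : ℕ → ℕ) : Prop :=
  ∀ p : Point, p.InGrid m →
    M (addr (base m) (leafX (treeSize m) p) (leafY (treeSize m) p) 9) = S.count p

/-- The memory represents `S`. -/
def Stored (m : ℕ) (S : Multiset Point) (M : ℕ → ℕ) : Prop :=
  (∀ a b, 1 ≤ a → a < base m → 1 ≤ b → b < base m → Good m S M a b) ∧ Counts m S M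

/-- The registers are prepared for recomputing the cells above the leaves of `p`. -/
structure Ready (m : ℕ) (p : Point) (s : NState) : Prop where
  r2 : s.r 2 = p.colour.code
  r3 : s.r 3 = p.x
  r4 : s.r 4 = p.y
  r10 : s.r 10 = treeSize m
  r11 : s.r 11 = base m
  r12 : s.r 12 = 0
  r14 : s.r 14 = leafY (treeSize m) p

theorem Ready.congr {m : ℕ} {p : Point} {s s' : NState} (h : Ready m p s)
    (hr : ∀ i < 15, s'.r i = s.r i) : Ready m p s' := by
  obtain ⟨h2, h3, h4, h10, h11, h12, h14⟩ := h
  constructor <;> rw [hr _ (by omega)] <;> assumption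

/-- All cells are right for `S`, except perhaps those of the pairs of ancestors of the leaves of `p`
from the pair `v`, `u` on. -/
def Climbed (m : ℕ) (S : Multiset Point) (p : Point) (M : ℕ → ℕ) (v u : ℕ) : Prop :=
  ∀ a b, 1 ≤ a → a < base m → 1 ≤ b → b < base m → Good m S M a b ∨
    Under a (leafX (treeSize m) p) ∧ Under b (leafY (treeSize m) p) ∧ (a < v ∨ a = v ∧ b ≤ u)

section Update

variable {w m : ℕ} {s : NState} {S : Multiset Point} {p : Point}

theorem lt_two_pow (hm : 2 ≤ m) (hW : base m ^ 16 ≤ 2 ^ w) : base m * base m * base m < 2 ^ w := by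
  have hB := sixteen_le_base hm
  calc base m * base m * base m = base m ^ 3 := by ring
    _ < base m ^ 16 := Nat.pow_lt_pow_right (by omega) (by omega)
    _ ≤ _ := hW

theorem base_bounds (hm : 2 ≤ m) (hW : base m ^ 16 ≤ 2 ^ w) :
    16 * base m < 2 ^ w ∧ base m * base m < 2 ^ w := by
  have hB := sixteen_le_base hm
  have := lt_two_pow hm hW
  constructor <;> nlinarith

/-- The tree size is found anew at every update by repeated doubling, which replaces preprocessing
and costs only O(log m). -/
theorem prepare_spec (hm : 2 ≤ m) (hW : base m ^ 16 ≤ 2 ^ w) (h0 : s.r 0 = m) :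
    HaltsIn w prepare s (12 * (Nat.clog 2 (2 * m + 2) + 1)) fun s' =>
      (∀ i < 10, s'.r i = s.r i) ∧ s'.M = s.M ∧ s'.r 10 = treeSize m ∧ s'.r 12 = 0 := by
  have hbb := (base_bounds hm hW).1
  have hN : base m = 2 * treeSize m := rfl
  have hlt := lt_treeSize m
  let L := Nat.clog 2 (2 * m + 2)
  let I (n : ℕ) (s' : NState) : Prop := (∃ i, i + n = L ∧ s'.r 10 = 2 ^ i) ∧
    (∀ i < 10, s'.r i = s.r i) ∧ s'.M = s.M ∧ s'.r 17 = 2 * m + 2 ∧ s'.r 12 = 0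
  have start : Halts w (block [assign 12 (.const 0), assign 10 (.const 1),
      assign 17 (.add (.mul (.const 2) (.var 0)) (.const 2))]) s (I L) := by
    refine .cons (.assign (by simp) (.cons (.assign (by simp only [Expr.Safe]; omega) (.cons (.assign
      (by simp [h0]; omega) (.nil ⟨⟨0, by simp⟩, fun i hi => ?_, rfl, by simp [h0], by simp⟩))))))
    simp [show i ≠ 17 by omega, show i ≠ 10 by omega, show i ≠ 12 by omega]
  -- With `i ≤ L` from the invariant, this shows that the loop stops exactly at `i = L`.
  have le_of_le : ∀ i, 2 * m + 2 ≤ 2 ^ i → L ≤ i := fun i => Nat.clog_le_of_le_pow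
  refine (HaltsIn.seq ((start.haltsIn (t := 10) (by decide) (by decide)).mono le_rfl
    fun s₁ h₁ => (HaltsIn.loop (t := 5) (by omega) (by omega) I (fun s' => ?_) (fun n s' => ?_) L s₁
      h₁).mono le_rfl fun s₂ ⟨⟨n, ⟨i, hi, h10⟩, hr, hM, h17, h12⟩, hle⟩ =>
        ⟨hr, hM, ?_, h12⟩)).mono ?_ fun _ h => h
  · rintro ⟨⟨i, hi, h10⟩, -, -, h17, -⟩
    have : 2 ^ i = treeSize m := by
      rw [treeSize]
      congr 1
    omega
  · rintro ⟨⟨i, hi, h10⟩, hr, hM, h17, h12⟩ hlt'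
    have hadd : s'.r 10 + s'.r 10 < 2 ^ w := by omega
    refine (Halts.assign (by simpa using hadd) ⟨⟨i + 1, by omega, ?_⟩, fun j hj => ?_, hM, ?_, ?_⟩
      |>.haltsIn (by decide) (by decide))
    · simp [h10]
      ring
    · simp [show j ≠ 10 by omega, hr j hj]
    · simp [h17]
    · simp [h12]
  · change 10 + (L * 6 + 1) ≤ 12 * (L + 1)
    omega
  · rw [h10, h17] at hle
    have := le_of_le i hle
    rw [h10, treeSize]
    congr 1
    omega

/-! ### The effect of an update on the multiset and on the stored cells. -/

/-- An allowed update concerns a point of the grid. -/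
theorem Update.Allowed.inGrid {u : Update} (hu : u.Allowed m S) (hS : ∀ p ∈ S, p.InGrid m) :
    u.point.InGrid m := by
  cases u with
  | insert p => exact hu.1
  | delete p => exact hS p hu

theorem Update.apply_inGrid {u : Update} (hu : u.Allowed m S) (hS : ∀ p ∈ S, p.InGrid m) :
    ∀ p ∈ u.apply S, p.InGrid m := by
  cases u with
  | insert p =>
    intro q hq
    rcases Multiset.mem_cons.1 hq with rfl | hq
    · exact hu.1
    · exact hS q hq
  | delete p => exact fun q hq => hS q (Multiset.mem_of_mem_erase hq)

theorem Update.apply_card_le {u : Update} (hu : u.Allowed m S) (hS : Multiset.card S ≤ m) :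
    Multiset.card (u.apply S) ≤ m := by
  cases u with
  | insert p => simpa [Update.apply] using hu.2
  | delete p => exact (Multiset.card_le_card (Multiset.erase_le p S)).trans hS

theorem Update.count_of_ne {u : Update} {q : Point} (hq : q ≠ u.point) :
    (u.apply S).count q = S.count q := by
  cases u with
  | insert p => exact Multiset.count_cons_of_ne hq S
  | delete p => exact Multiset.count_erase_of_ne hq S

theorem Update.mem_iff_of_ne {u : Update} {q : Point} (hq : q ≠ u.point) :
    q ∈ u.apply S ↔ q ∈ S := by
  rw [← Multiset.count_pos, count_of_ne hq, Multiset.count_pos]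

/-- An update outside a rectangle changes membership of no point inside it. Together with the
trivial bounds on ancestors this starts the climb. -/
theorem Good.apply {u : Update} {M : ℕ → ℕ} {a b : ℕ} (h : Good m S M a b)
    (hab : ¬ (Under a (leafX (treeSize m) u.point) ∧ Under b (leafY (treeSize m) u.point))) :
    Good m (u.apply S) M a b := by
  have hmem : ∀ q : Point, Under a (leafX (treeSize m) q) → Under b (leafY (treeSize m) q) →
      (q ∈ u.apply S ↔ q ∈ S) := fun q h1 h2 =>
    Update.mem_iff_of_ne fun e => hab (e ▸ ⟨h1, h2⟩)
  constructor
  · intro c f hf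
    convert h.keys c f hf using 1
    ext k
    constructor
    · rintro ⟨p, hp, hc, hx, hy, e⟩
      exact ⟨p, (hmem p hx hy).1 hp, hc, hx, hy, e⟩
    · rintro ⟨p, hp, hc, hx, hy, e⟩
      exact ⟨p, (hmem p hx hy).2 hp, hc, hx, hy, e⟩
  · convert h.pairs using 1
    ext k
    constructor
    · rintro ⟨p, q, ⟨hp, hq, hc⟩, h1, h2, e⟩
      exact ⟨p, q, ⟨(hmem p h1.1 h1.2).1 hp, (hmem q h2.1 h2.2).1 hq, hc⟩, h1, h2, e⟩
    · rintro ⟨p, q, ⟨hp, hq, hc⟩, h1, h2, e⟩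
      exact ⟨p, q, ⟨(hmem p h1.1 h1.2).2 hp, (hmem q h2.1 h2.2).2 hq, hc⟩, h1, h2, e⟩

theorem count_spec {u : Update} (hm : 2 ≤ m) (hW : base m ^ 16 ≤ 2 ^ w)
    (hS : ∀ p ∈ S, p.InGrid m) (hcard : Multiset.card S ≤ m) (hu : u.Allowed m S)
    (hM : Stored m S s.M) (h1 : s.r 1 = u.kindCode) (h2 : s.r 2 = u.point.colour.code)
    (h3 : s.r 3 = u.point.x) (h4 : s.r 4 = u.point.y) (h10 : s.r 10 = treeSize m)
    (h12 : s.r 12 = 0) :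
    Halts w count s fun s' => s'.r 0 = s.r 0 ∧ Ready m u.point s' ∧
      s'.r 15 = leafX (treeSize m) u.point ∧ Counts m (u.apply S) s'.M ∧
      Climbed m (u.apply S) u.point s'.M (leafX (treeSize m) u.point)
        (leafY (treeSize m) u.point) := by
  have hB := sixteen_le_base hm
  have hN : base m = 2 * treeSize m := rfl
  have hp := hu.inGrid hS
  obtain ⟨x1, x2⟩ := leafX_bounds hp
  obtain ⟨y1, y2⟩ := leafY_bounds hp
  rw [← hN] at x2 y2
  have b20 := addr_lt hB hW x2 y2
  have hb := (base_bounds hm hW).1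
  set p := u.point with hpdef
  have hxe : treeSize m + (p.x + p.x + p.colour.code) = leafX (treeSize m) p := rfl
  have hye : treeSize m + (p.y + p.y + p.colour.code) = leafY (treeSize m) p := rfl
  have hcnt : S.count p ≤ m := (Multiset.count_le_card p S).trans hcard
  have hmB := lt_treeSize m
  have lxB : leafX (treeSize m) p * base m ≤ (leafX (treeSize m) p * base m +
    leafY (treeSize m) p) * 16 := by omega
  let A := (leafX (treeSize m) p * base m + leafY (treeSize m) p) * 16
  let s₄ := (((s.set 11 (base m)).set 13 (leafX (treeSize m) p)).set 14
    (leafY (treeSize m) p)).set 20 A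
  have eA : s.M (A + 9) = S.count p := hM.2 p hp
  -- The common end of insertion and deletion; `n` is the new multiplicity and `t` the irrelevant
  -- content of scratch register 24.
  have fin : ∀ n t, n = (u.apply S).count p →
      Halts w (block [write (fieldE 20 9) 23, assign 15 (.var 13)])
        (((s₄.set 23 (S.count p)).set 24 t).set 23 n)
        fun s' => s'.r 0 = s.r 0 ∧ Ready m p s' ∧
          s'.r 15 = leafX (treeSize m) p ∧ Counts m (u.apply S) s'.M ∧
          Climbed m (u.apply S) p s'.M (leafX (treeSize m) p) (leafY (treeSize m) p) := by
    intro n t hn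
    refine .cons (.write ?_ (by omega) (.cons (.assign (by simp) (.nil ⟨?_, ?_, ?_, ?_, ?_⟩))))
    · simp [s₄, A]
      omega
    · simp [s₄]
    · constructor <;> simp [s₄, *]
    · simp [s₄]
    · intro q hq
      by_cases hqp : q = p
      · simp [hqp, s₄, addr, A, hn]
      · have hne : addr (base m) (leafX (treeSize m) q) (leafY (treeSize m) q) 9 ≠ A + 9 :=
          fun e => by
            obtain ⟨e1, e2, -⟩ := addr_inj (leafY_bounds hq).2 y2 (by omega) (by omega) e
            exact hqp (eq_of_leaf_eq e1 e2)
        rw [Update.count_of_ne hqp, ← hM.2 q hq]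
        simp [s₄, hne]
    · intro a b a1 aB b1 bB
      by_cases hab : Under a (leafX (treeSize m) p) ∧ Under b (leafY (treeSize m) p)
      · refine .inr ⟨hab.1, hab.2, ?_⟩
        have := hab.1.le
        have := hab.2.le
        omega
      · refine .inl (((hM.1 a b a1 aB b1 bB).apply hab).congr fun j hj => ?_)
        have hne : addr (base m) a b j ≠ A + 9 := fun e => by
          obtain ⟨-, -, e3⟩ := addr_inj bB y2 (by omega) (by omega) e
          omega
        simp [s₄, hne]
  refine .cons (.assign (by simp [h10]; omega) (.cons (.assign (by simp [h10, h3, h2]; omega)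
    (.cons (.assign (by simp [h10, h4, h2]; omega) (.cons (.assign ?_ (.cons
    (.fetch ?_ (.cons (.assign (by simp only [Expr.Safe]; omega) (.cons ?_))))))))))))
  · simp [h10, h2, h3, h4, ← hN, hxe, hye]
    omega
  · simp [h10, h2, h3, h4, ← hN, hxe, hye]
    omega
  simp [h10, h2, h3, h4, ← hN, hxe, hye]
  change Halts w _ ((s₄.set 23 (s.M (A + 9))).set 24 1) _
  rw [eA]
  refine .ite_eq (by omega) (by omega) (fun hk => ?_) fun hk => ?_
  · have hk' : u.kindCode = 0 := by simpa [s₄, h1, h12] using hk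
    have hadd : S.count p + 1 < 2 ^ w := by omega
    refine .assign (by simpa [s₄] using hadd) ?_
    refine fin _ 1 ?_
    cases u with
    | insert q => simp [hpdef, Update.point, Update.apply]
    | delete q => simp [Update.kindCode] at hk'
  · have hk' : u.kindCode ≠ 0 := by simpa [s₄, h1, h12] using hk
    cases u with
    | insert q => simp [Update.kindCode] at hk'
    | delete q =>
      -- A deleted point is present, so the decrement does not wrap around.
      have hmem : 1 ≤ S.count p := Multiset.one_le_count_iff_mem.2 hu
      refine .sub (by omega) (by omega) (by simpa using hmem) ?_
      refine fin _ 1 ?_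
      simp [hpdef, Update.point, Update.apply]

/-- Both loops halve a number below `2 ^ (L + 1)`, so there are at most `L + 1` rounds of each. The
set of possibly wrong pairs shrinks in lexicographic order: `(v, u)` is repaired after all ancestor
pairs that follow it. -/
theorem climb_spec (hm : 2 ≤ m) (hW : base m ^ 16 ≤ 2 ^ w) (hS : ∀ p ∈ S, p.InGrid m)
    (hp : p.InGrid m) (hr : Ready m p s) (h15 : s.r 15 = leafX (treeSize m) p)
    (hc : Counts m S s.M)
    (hM : Climbed m S p s.M (leafX (treeSize m) p) (leafY (treeSize m) p)) {c : ℕ}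
    (hcost : cost (block [node, assign 16 (.div (.var 16) (.const 2))]) ≤ c) :
    HaltsIn w climb s ((c + 9) * (Nat.clog 2 (2 * m + 2) + 2) ^ 2) fun s' =>
      s'.r 0 = s.r 0 ∧ s'.r 11 = base m ∧ Stored m S s'.M := by
  have hB := sixteen_le_base hm
  have hN : base m = 2 * treeSize m := rfl
  obtain ⟨x1, x2⟩ := leafX_bounds hp
  obtain ⟨y1, y2⟩ := leafY_bounds hp
  rw [← hN] at x2 y2
  have hw2 : 2 < 2 ^ w := by
    have := (base_bounds hm hW).1
    omega
  set L := Nat.clog 2 (2 * m + 2) with hL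
  have hBL : base m = 2 ^ (L + 1) := by rw [hN, treeSize, pow_succ, mul_comm]
  -- The bound `2 ^ n` on the node makes `n` a bound for the remaining halvings.
  let J (n : ℕ) (s' : NState) : Prop := s'.r 15 < 2 ^ n ∧
    (s'.r 15 ≠ 0 → Under (s'.r 15) (leafX (treeSize m) p)) ∧ (∀ i < 15, s'.r i = s.r i) ∧
    Counts m S s'.M ∧ Climbed m S p s'.M (s'.r 15) (leafY (treeSize m) p)
  have inner : ∀ s₁ : NState, (∀ i < 15, s₁.r i = s.r i) → 1 ≤ s₁.r 15 →
      Under (s₁.r 15) (leafX (treeSize m) p) → s₁.r 16 = leafY (treeSize m) p →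
      Counts m S s₁.M → Climbed m S p s₁.M (s₁.r 15) (leafY (treeSize m) p) →
      HaltsIn w (.loop (.lt 12 16) (block [node, assign 16 (.div (.var 16) (.const 2))])) s₁
        ((L + 1) * (c + 1) + 1) fun s' => (∀ i < 16, s'.r i = s₁.r i) ∧ Counts m S s'.M ∧
          Climbed m S p s'.M (s₁.r 15) 0 := by
    intro s₁ hr₁ hv1 hv h16 hc₁ hM₁
    let I (n : ℕ) (s' : NState) : Prop := s'.r 16 < 2 ^ n ∧
      (s'.r 16 ≠ 0 → Under (s'.r 16) (leafY (treeSize m) p)) ∧ (∀ i < 16, s'.r i = s₁.r i) ∧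
      Counts m S s'.M ∧ Climbed m S p s'.M (s₁.r 15) (s'.r 16)
    refine (HaltsIn.loop (t := c) (by omega) (by omega) I (fun s' h => ?_) (fun n s' h hlt => ?_)
      (L + 1) s₁ ⟨by rw [h16, ← hBL]; exact y2, fun _ => h16 ▸ .refl _, fun _ _ => rfl, hc₁,
        h16 ▸ hM₁⟩).mono le_rfl fun s' ⟨⟨n, _, _, hr', hc', hM'⟩, hle⟩ => ⟨hr', hc', ?_⟩
    · have := h.1
      omega
    · obtain ⟨hlt', hu, hr', hc', hM'⟩ := h
      have hrd : Ready m p s' := (hr.congr hr₁).congr fun i hi => hr' i (by omega)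
      rw [hrd.r12] at hlt
      have e15 : s'.r 15 = s₁.r 15 := hr' 15 (by omega)
      set v := s₁.r 15 with hvdef
      set u := s'.r 16 with hudef
      have hu' := hu (by omega)
      refine Halts.haltsIn (.cons ((node_spec (v := v) (u := u) hm hW hS hp hrd.r2 hrd.r3 hrd.r4
        hrd.r10 hrd.r11 hrd.r12 e15 rfl hv1 hlt hv hu' (hc' p hp)
        fun a b a1 aB b1 bB hab => ?_).mono fun s₂ ⟨hr₂, hg₂, hM₂⟩ => .cons (.assign
          (by simpa using hw2) (.nil ⟨?_, ?_, ?_, ?_, ?_⟩)))) (by decide) hcost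
      · rcases hM' a b a1 aB b1 bB with h | ⟨-, -, h⟩
        · exact h
        · omega
      · have := hr₂ 16 (by omega)
        rw [pow_succ] at hlt'
        simp [this]
        omega
      · intro _
        simpa [hr₂ 16 (by omega)] using hu'.half
      · intro i hi
        simp [show i ≠ 16 by omega, hr₂ i (by omega), hr' i hi]
      · intro q hq
        rw [NState.set_M, hM₂ _ fun j hj e => ?_]
        · exact hc' q hq
        · have := addr_inj (leafY_bounds hq).2 (hu'.le.trans_lt y2) (by omega) (by omega) e
          omega
      · intro a b a1 aB b1 bB
        have huB := hu'.le.trans_lt y2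
        by_cases hab : a = v ∧ b = u
        · rw [hab.1, hab.2]
          exact .inl hg₂
        rcases hM' a b a1 aB b1 bB with h | ⟨h1, h2, h⟩
        · exact .inl (h.congr fun j hj => hM₂ _ fun i hi e => hab (by
            have := addr_inj bB huB (by omega) (by omega) e
            exact ⟨this.1, this.2.1⟩))
        · refine .inr ⟨h1, h2, h.imp id fun ⟨e, hb⟩ => ⟨e, ?_⟩⟩
          -- A pair in row `v` that is still wrong has `b < u`, and ancestors below `u` are at most
          -- `u / 2`.
          have := h2.le_half hu' (by omega)
          simpa [hr₂ 16 (by omega)] using this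
    · have : s'.r 12 = 0 := by rw [hr' 12 (by omega), hr₁ 12 (by omega), hr.r12]
      have h0 : s'.r 16 = 0 := by omega
      rwa [h0] at hM'
  have outer := HaltsIn.loop (w := w) (p := .seq (assign 16 (.var 14))
    (.seq (.loop (.lt 12 16) (block [node, assign 16 (.div (.var 16) (.const 2))]))
      (assign 15 (.div (.var 15) (.const 2))))) (a := 12) (b := 15)
    (t := 2 + ((L + 1) * (c + 1) + 1 + 4)) (by omega) (by omega) J ?_ ?_ (L + 1) s
    ⟨by rw [h15, ← hBL]; exact x2, fun _ => h15 ▸ .refl _, fun _ _ => rfl, hc, h15 ▸ hM⟩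
  · refine outer.mono ?_ fun s' ⟨⟨n, _, _, hr', hc', hM'⟩, hle⟩ => ⟨hr' 0 (by omega), ?_, ?_, hc'⟩
    · nlinarith
    · rw [hr' 11 (by omega), hr.r11]
    · intro a b a1 aB b1 bB
      have : s'.r 12 = 0 := by rw [hr' 12 (by omega), hr.r12]
      exact (hM' a b a1 aB b1 bB).resolve_right fun ⟨_, _, h⟩ => by omega
  · intro s' h
    have := h.1
    omega
  · rintro n s' ⟨hlt', hv, hr', hc', hM'⟩ hlt
    have e12 : s'.r 12 = 0 := by rw [hr' 12 (by omega), hr.r12]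
    have hv' := hv (by omega)
    refine HaltsIn.seq ((Halts.assign (Q := fun s₁ => s₁ = s'.set 16 (s'.r 14)) (by simp)
      rfl).haltsIn (by decide) (by decide) |>.mono le_rfl ?_)
    rintro s₁ rfl
    refine HaltsIn.seq ((inner (s'.set 16 (s'.r 14)) (fun i hi => ?_) ?_ ?_ ?_ hc' ?_).mono le_rfl
      fun s₂ ⟨hr₂, hc₂, hM₂⟩ => Halts.haltsIn (.assign (by simpa using hw2)
        ⟨?_, fun _ => ?_, fun i hi => ?_, hc₂, ?_⟩) (by decide) (by decide))
    · simp [show i ≠ 16 by omega, hr' i hi]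
    · simp
      omega
    · simpa using hv'
    · simp [hr' 14 (by omega), hr.r14]
    · simpa using hM'
    · have := hr₂ 15 (by omega)
      rw [pow_succ] at hlt'
      simp at this ⊢
      omega
    · simpa [hr₂ 15 (by omega)] using hv'.half
    · simp [show i ≠ 15 by omega, hr₂ i (by omega), show i ≠ 16 by omega, hr' i hi]
    · intro a b a1 aB b1 bB
      refine (hM₂ a b a1 aB b1 bB).imp id fun ⟨h1, h2, h⟩ => ⟨h1, h2, ?_⟩
      have e15 : s₂.r 15 = s'.r 15 := by simp [hr₂ 15 (by omega)]
      -- The inner loop ended at node 0 and `1 ≤ b`, so no wrong pair is left in the row of the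
      -- current x-node.
      have h' : a < s'.r 15 := by
        simp at h
        omega
      have := h1.le_half hv' h'
      have := h2.le
      simp [e15]
      omega

end Update

/-! ### The answer -/

section Answer

variable {w m : ℕ} {s : NState} {S : Multiset Point} {p q : Point}

theorem pairKey_eq (B : ℕ) (p q : Point) :
    pairKey B p q = (((pairValue p q * B + p.x) * B + p.y) * B + q.x) * B + q.y := by
  unfold pairKey pack
  ring

theorem mul_add_div_mod {B q r : ℕ} (hr : r < B) : (q * B + r) / B = q ∧ (q * B + r) % B = r := by
  constructor
  · rw [Nat.add_div_of_dvd_right ⟨q, mul_comm _ _⟩, Nat.mul_div_cancel _ (by omega),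
      Nat.div_eq_of_lt hr, add_zero]
  · rw [add_comm, Nat.add_mul_mod_self_right, Nat.mod_eq_of_lt hr]

/-- In Horner form the four coordinates are the lowest base-B digits of the key. -/
theorem unpack {B : ℕ} {p q : Point} (hx : p.x < B) (hy : p.y < B) (hx' : q.x < B)
    (hy' : q.y < B) : pairKey B p q / (B * (B * B)) % B = p.x ∧ pairKey B p q / (B * B) % B = p.y ∧
      pairKey B p q / B % B = q.x ∧ pairKey B p q % B = q.y := by
  simp only [pairKey_eq, ← Nat.div_div_eq_div_mul, (mul_add_div_mod hx).2,
    (mul_add_div_mod hy).1, (mul_add_div_mod hy).2, (mul_add_div_mod hx').1,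
    (mul_add_div_mod hx').2, (mul_add_div_mod hy').1, (mul_add_div_mod hy').2, and_self]

/-- The packed coordinates of `p` and `q` stay below `base m ^ 4`, so a larger value of a pair would
outweigh them. -/
theorem pairValue_le {p' q' : Point} (hp : p.InGrid m) (hq : q.InGrid m)
    (h : pairKey (base m) p' q' ≤ pairKey (base m) p q) : pairValue p' q' ≤ pairValue p q := by
  have h1 := pack_lt hp
  have h2 := pack_lt hq
  by_contra hc
  have h3 : pack (base m) p * base m ^ 2 + pack (base m) q < base m ^ 4 := by
    calc pack (base m) p * base m ^ 2 + pack (base m) q < (pack (base m) p + 1) * base m ^ 2 := by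
          rw [Nat.succ_mul]
          omega
      _ ≤ base m ^ 2 * base m ^ 2 := Nat.mul_le_mul_right _ h1
      _ = _ := by ring
  have h4 : (pairValue p q + 1) * base m ^ 4 ≤ pairValue p' q' * base m ^ 4 :=
    Nat.mul_le_mul_right _ (by omega)
  rw [Nat.succ_mul] at h4
  unfold pairKey at h
  omega

theorem pairKey_pos (hq : q.InGrid m) : 0 < pairKey (base m) p q := by
  have := pack_pos (B := base m) hq
  unfold pairKey
  omega

/-- `State.Answers` for natural numbers. -/
def NAnswers (s : NState) (S : Multiset Point) : Prop :=
  (s.r 5 = 0 ∧ ¬ ∃ p q : Point, IsBichromaticPair S p q) ∨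
  (s.r 5 ≠ 0 ∧ IsBestPair S ⟨.red, s.r 6, s.r 7⟩ ⟨.blue, s.r 8, s.r 9⟩)

/-- The pair of roots `(1, 1)` stands for the whole grid, so its cell 8 is the key of a best pair.
-/
theorem answer_spec (hm : 2 ≤ m) (hW : base m ^ 16 ≤ 2 ^ w) (hS : ∀ p ∈ S, p.InGrid m)
    (h11 : s.r 11 = base m) (hM : Stored m S s.M) :
    Halts w answer s fun s' => s'.r 0 = s.r 0 ∧ s'.M = s.M ∧ NAnswers s' S := by
  have hB := sixteen_le_base hm
  obtain ⟨b1, b2⟩ := base_bounds hm hW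
  have b3 := lt_two_pow hm hW
  rw [mul_assoc] at b3
  have hlt := addr_lt (a := 1) (b := 1) hB hW (by omega) (by omega)
  have ea : (1 * base m + 1) * 16 + 8 = addr (base m) 1 1 8 := rfl
  refine .cons (.assign (by simp only [Expr.Safe]; omega) (.cons (.fetch ?_ (.cons (.assign ?_
    (.cons (.assign ?_ (.cons (.assign (by simp) (.cons (.assign (by simp)
      (.nil ⟨by simp, rfl, ?_⟩))))))))))))
  · simp [h11]
    omega
  · simp [h11, b2, b3]
  · simp [h11, b2]
  have pairs_mem : ∀ p q, IsBichromaticPair S p q → pairKey (base m) p q ∈ pairs m S 1 1 := by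
    intro p q h
    have l := lt_treeSize m
    have := leafX_bounds (hS p h.1)
    have := leafY_bounds (hS p h.1)
    have := leafX_bounds (hS q h.2.1)
    have := leafY_bounds (hS q h.2.1)
    exact ⟨p, q, h, ⟨under_one (by omega), under_one (by omega)⟩,
      ⟨under_one (by omega), under_one (by omega)⟩, rfl⟩
  have hT := (hM.1 1 1 le_rfl (by omega) le_rfl (by omega)).pairs
  rw [← ea] at hT
  simp only [one_mul] at hT
  simp only [NAnswers, NState.set_r, NState.set_M, Expr.eval, cellE, h11]
  simp only [if_true, one_mul, Nat.reduceEqDiff, if_false]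
  by_cases h0 : s.M ((base m + 1) * 16 + 8) = 0
  · refine .inl ⟨h0, ?_⟩
    rintro ⟨p, q, h⟩
    have := hT.1 _ (pairs_mem p q h)
    have := pairKey_pos (p := p) (hS q h.2.1)
    omega
  · refine .inr ⟨h0, ?_⟩
    obtain ⟨p, q, h, -, -, e⟩ := hT.2 h0
    have hp := hS p h.1
    have hq := hS q h.2.1
    obtain ⟨u1, u2, u3, u4⟩ := unpack (lt_base hp).1 (lt_base hp).2 (lt_base hq).1 (lt_base hq).2
    rw [e, u1, u2, u3, u4]
    have e1 : (⟨.red, p.x, p.y⟩ : Point) = p := by rw [← h.2.2.1]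
    have e2 : (⟨.blue, q.x, q.y⟩ : Point) = q := by rw [← h.2.2.2]
    rw [e1, e2]
    refine ⟨h, fun p' q' h' => pairValue_le hp hq ?_⟩
    rw [← e]
    exact hT.1 _ (pairs_mem p' q' h')

/-- One update. -/
theorem process_spec {u : Update} (hm : 2 ≤ m) (hW : base m ^ 16 ≤ 2 ^ w)
    (hS : ∀ p ∈ S, p.InGrid m) (hcard : Multiset.card S ≤ m) (hu : u.Allowed m S)
    (hM : Stored m S s.M) (h0 : s.r 0 = m) (h1 : s.r 1 = u.kindCode)
    (h2 : s.r 2 = u.point.colour.code) (h3 : s.r 3 = u.point.x) (h4 : s.r 4 = u.point.y) :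
    HaltsIn w process s (1200 * (Nat.clog 2 (2 * m + 2) + 2) ^ 2) fun s' =>
      s'.r 0 = m ∧ Stored m (u.apply S) s'.M ∧ NAnswers s' (u.apply S) := by
  have hS' := Update.apply_inGrid hu hS
  refine (HaltsIn.seq ((prepare_spec hm hW h0).mono le_rfl fun s₁ ⟨hr₁, hM₁, h10, h12⟩ =>
    HaltsIn.seq (((count_spec hm hW hS hcard hu (hM₁ ▸ hM) (by rw [hr₁ 1 (by omega), h1])
      (by rw [hr₁ 2 (by omega), h2]) (by rw [hr₁ 3 (by omega), h3])
      (by rw [hr₁ 4 (by omega), h4]) h10 h12).haltsIn (t := 100) (by decide) (by decide)).mono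
      le_rfl fun s₂ ⟨e₂, hr₂, h15, hc, hcl⟩ => HaltsIn.seq ((climb_spec hm hW hS'
        (hu.inGrid hS) hr₂ h15 hc hcl (c := 1000) (by decide)).mono le_rfl
        fun s₃ ⟨e₃, h11, hM₃⟩ => ((answer_spec hm hW hS' h11 hM₃).haltsIn (t := 100) (by decide)
          (by decide)).mono le_rfl fun s₄ ⟨e₄, hM₄, ha⟩ => ⟨?_, hM₄ ▸ hM₃, ha⟩)))).mono ?_
            fun _ h => h
  · set L := Nat.clog 2 (2 * m + 2)
    nlinarith
  · rw [e₄, e₃, e₂, hr₁ 0 (by omega), h0]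

/-! ### From one update to sequences of updates. -/

theorem answers_of_rep {σ : State w} (h : Rep σ s) (ha : NAnswers s S) : σ.Answers S := by
  have h5 : σ.reg 5 = 0 ↔ s.r 5 = 0 := by
    rw [← h.1 5 (by omega)]
    exact BitVec.toNat_inj.symm
  unfold State.Answers
  rw [ne_eq, h5, h.1 6 (by omega), h.1 7 (by omega), h.1 8 (by omega), h.1 9 (by omega)]
  exact ha

/-- The initial memory is already a valid structure because 0 codes both an empty set of keys and
multiplicity zero. -/
theorem stored_empty (m : ℕ) : Stored m 0 fun _ => 0 := by
  refine ⟨fun a b _ _ _ _ => ⟨fun c f _ => ?_, ?_⟩, fun p _ => by simp⟩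
  · have : keys m 0 c f a b = ∅ := by
      ext k
      simp [keys]
    rw [this]
    exact .empty
  · have : pairs m 0 a b = ∅ := by
      ext k
      simp [pairs, IsBichromaticPair]
    rw [this]
    exact .empty

theorem serves_of_stored (hm : 2 ≤ m) (hW : base m ^ 16 ≤ 2 ^ w) (us : List Update) :
    ∀ (S : Multiset Point) (σ : State w) (M : ℕ → ℕ), (∀ p ∈ S, p.InGrid m) →
      Multiset.card S ≤ m → ValidUpdates m S us → (σ.reg 0).toNat = m →
      (∀ a, (σ.mem a).toNat = M a.toNat) → Stored m S M →
      ∃ t, Serves process σ S us t ∧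
        t ≤ us.length * (1200 * (Nat.clog 2 (2 * m + 2) + 2) ^ 2) := by
  have hmw : 2 * m + 2 < 2 ^ w := by
    have := (base_bounds hm hW).1
    have := lt_treeSize m
    have : base m = 2 * treeSize m := rfl
    omega
  induction us with
  | nil => exact fun S σ M _ _ _ _ _ _ => ⟨0, .nil σ S, by simp⟩
  | cons u us ih =>
    intro S σ M hS hcard ⟨hu, hus⟩ h0 hM hst
    have hp := hu.inGrid hS
    have small : ∀ k ≤ m, k % 2 ^ w = k := fun k hk => Nat.mod_eq_of_lt (by omega)
    have hk : u.kindCode ≤ m := by cases u <;> simp [Update.kindCode]; omega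
    have hc : u.point.colour.code ≤ m := u.point.colour.code_le.trans (by omega)
    have hrep : Rep (σ.feed u) ⟨fun i => ((σ.feed u).reg i).toNat, M⟩ := ⟨fun _ _ => rfl, hM⟩
    obtain ⟨σ', s', t, he, ht, hr', e0, hst', ha⟩ := process_spec (w := w)
      (s := ⟨fun i => ((σ.feed u).reg i).toNat, M⟩) hm hW hS hcard hu hst
      (by simpa [State.feed, State.setReg] using h0)
      (by simpa [State.feed, State.setReg] using small _ hk)
      (by simpa [State.feed, State.setReg] using small _ hc)
      (by simpa [State.feed, State.setReg] using small _ hp.1.2)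
      (by simpa [State.feed, State.setReg] using small _ hp.2.2) (σ.feed u) hrep
    obtain ⟨t', hs, ht'⟩ := ih (u.apply S) σ' s'.M (Update.apply_inGrid hu hS)
      (Update.apply_card_le hu hcard) hus ((hr'.1 0 (by omega)).trans e0) hr'.2 hst'
    refine ⟨t + t', .cons he (answers_of_rep hr' ha) hs, ?_⟩
    rw [List.length_cons, Nat.succ_mul]
    omega

/-! ### Constants of the final bounds. -/

/-- Rounding gives at most `Nat.log 2 m + 4`, and `m ≥ 2` makes the logarithm at least 1, so the 4
is absorbed. -/
theorem clog_add_two_le (hm : 2 ≤ m) : Nat.clog 2 (2 * m + 2) + 2 ≤ 5 * Nat.log 2 m := by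
  have h1 : 1 ≤ Nat.log 2 m := Nat.log_pos (by omega) hm
  have h2 : m < 2 ^ (Nat.log 2 m + 1) := Nat.lt_pow_succ_log_self (by omega) m
  have h3 : Nat.clog 2 (2 * m + 2) ≤ Nat.log 2 m + 2 := by
    refine Nat.clog_le_of_le_pow ?_
    rw [pow_succ]
    omega
  omega

theorem base_pow_le {c : ℕ} (hm : 2 ≤ m) (hc : 80 ≤ c) : base m ^ 16 ≤ m ^ c := by
  -- `base m < 8 * m + 8 ≤ 16 * m`, and `16 ≤ m ^ 4`.
  have h1 : base m ≤ m ^ 5 := by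
    have h2 := treeSize_lt m
    have h3 : 2 ^ 4 * m ≤ m ^ 4 * m := Nat.mul_le_mul_right _ (Nat.pow_le_pow_left hm 4)
    have h4 : m ^ 4 * m = m ^ 5 := (pow_succ m 4).symm
    unfold base
    omega
  calc base m ^ 16 ≤ (m ^ 5) ^ 16 := Nat.pow_le_pow_left h1 16
    _ = m ^ 80 := by rw [← pow_mul]
    _ ≤ _ := Nat.pow_le_pow_right (by omega) hc

end Answer

end BichromaticPoint

open BichromaticPoint
/-- One program `P` and constants `c`, `C` such that for all `m ≥ 2` and every word length
`w ≥ c log₂ m`, `P` solves the dynamic problem, starting from the empty multiset, and any sequence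
of `k` updates takes at most `C k (log₂ m)²` steps in total. -/
theorem mainTheorem7 :
    ∃ (P : Program) (c C : ℕ), ∀ m w : ℕ, 2 ≤ m → m ^ c ≤ 2 ^ w →
      ∀ us : List Update, ValidUpdates m 0 us →
        ∃ t : ℕ, Serves P (initialState w m) 0 us t ∧
          (t : ℝ) ≤ (C : ℝ) * (us.length : ℝ) * (Real.logb 2 (m : ℝ)) ^ 2 := by
  -- 80 = 5 · 16 from `base m ≤ m ^ 5` and the word bound `base m ^ 16`; 30000 = 1200 · 5² from the
  -- cost of one update and `clog_add_two_le`.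
  refine ⟨process, 80, 30000, fun m w hm hw us hus => ?_⟩
  have hW : base m ^ 16 ≤ 2 ^ w := (base_pow_le hm le_rfl).trans hw
  have hmw : m < 2 ^ w := by
    calc m = m ^ 1 := (pow_one m).symm
      _ < m ^ 80 := Nat.pow_lt_pow_right (by omega) (by omega)
      _ ≤ _ := hw
  obtain ⟨t, hs, ht⟩ := serves_of_stored hm hW us 0 (initialState w m) (fun _ => 0) (by simp)
    (by simp) hus (by simpa [initialState] using Nat.mod_eq_of_lt hmw)
    (fun a => by simp [initialState]) (stored_empty m)
  refine ⟨t, hs, ?_⟩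
  have h1 : t ≤ 30000 * us.length * Nat.log 2 m ^ 2 := by
    calc t ≤ us.length * (1200 * (Nat.clog 2 (2 * m + 2) + 2) ^ 2) := ht
      _ ≤ us.length * (1200 * (5 * Nat.log 2 m) ^ 2) := by
        gcongr
        exact clog_add_two_le hm
      _ = _ := by ring
  calc (t : ℝ) ≤ ((30000 * us.length * Nat.log 2 m ^ 2 : ℕ) : ℝ) := by exact_mod_cast h1
    _ = (30000 : ℕ) * us.length * (Nat.log 2 m : ℝ) ^ 2 := by push_cast; ring
    _ ≤ _ := by
      gcongr
      exact Real.natLog_le_logb m 2
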